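/- Let $d\in\mathbb N$ and let $A\in M_d(\{0,1\})$ be aperiodic, i.e. some power $A^N$ with $N\ge 1$ has only strictly positive entries. Let $\mathcal O_A$ be the Cuntz–Krieger algebra of $A$, i.e. the universal unital $C^*$-algebra generated by partial isometries $s_1,\dots,s_d$ with $\sum_i s_is_i^*=1$ and $s_i^*s_i=\sum_j A_{ij}s_js_j^*$ for all $i$. Let $\Lambda_A=\{(x_k)_{k}\in\{1,\dots,d\}^{\mathbb N}: A_{x_kx_{k+1}}=1 \text{ for all } k\}$ be the one-sided Markov subshift, with first coordinate denoted $x_1$, and regard $C(\Lambda_A)$ (complex-valued continuous functions) as a $C^*$-subalgebra of $\mathcal O_A$ by identifying the indicator function of each cylinder $\{x: x_1=i_1,\dots,x_r=i_r\}$ with the projection $s_{i_1}\cdots s_{i_r}(s_{i_1}\cdots s_{i_r})^*$. Let $a\in C(\Lambda_A)$ be self-adjoint and $\beta\in\mathbb R$. Let $\alpha^{\beta,a}=(\alpha^{\beta,a}_t)_{t\in\mathbb R}$ be the one-parameter automorphism group of $\mathcal O_A$ with $\alpha^{\beta,a}_t(s_i)=e^{it(\beta-a)}s_i$ for $i=1,\dots,d$.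 A state $\omega$ of $\mathcal O_A$ is an $(\alpha^{\beta,a},1)$-KMS state if for all $x,y\in\mathcal O_A$ there is a bounded continuous function $F$ on $\{z\in\mathbb C: 0\le \operatorname{Im} z\le 1\}$, analytic in the interior, with $F(t)=\omega(x\,\alpha^{\beta,a}_t(y))$ and $F(t+i)=\omega(\alpha^{\beta,a}_t(y)\,x)$ for all $t\in\mathbb R$. Let $\mathcal L_a$ be the Ruelle transfer operator on $C(\Lambda_A)$, $$(\mathcal L_a f)(x)=\sum_{i:\,A_{i x_1}=1} e^{a(ix)}f(ix),$$ and $\mathcal L_a^*$ its Banach space adjoint. Then restriction $\omega\mapsto\mu:=\omega|_{C(\Lambda_A)}$ (restricted states being identified with Borel probability measures on $\Lambda_A$) maps the set of $(\alpha^{\beta,a},1)$-KMS states of $\mathcal O_A$ into, and onto, the set of Borel probability measures $\mu$ on $\Lambda_A$ with $\mathcal L_a^*\mu=e^\beta\mu$, that is, with $\int \mathcal L_a f\,d\mu=e^\beta\int f\,d\mu$ for all $f\in C(\Lambda_A)$. If in addition $\operatorname{var}_0(a):=\max a-\min a<\log r(A)$, where $r(A)$ is the spectral radius of $A$, then this map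 is a bijection. -/

import Mathlib

noncomputable section

namespace CuntzKrieger

/-! ### The Cuntz–Krieger relations -/

/-- A Cuntz–Krieger family for `A`: partial isometries `s i` in a unital star-ring with
`∑ i, s i (s i)* = 1` and `(s i)* (s i) = ∑ j, A i j s j (s j)*`. -/
structure IsCKFamily {d : ℕ} (A : Matrix (Fin d) (Fin d) ℕ) {B : Type*} [Ring B] [StarRing B]
    (s : Fin d → B) : Prop where
  partial_isometry : ∀ i, s i * star (s i) * s i = s i
  sum_range : ∑ i, s i * star (s i) = 1
  source : ∀ i, star (s i) * s i = ∑ j, A i j • (s j * star (s j))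

/-! ### The free unital star-algebra on `d` generators -/

/-- The free unital complex star-algebra on `d` generators: noncommutative polynomials in the
letters `(i, false)` (the `i`-th generator) and `(i, true)` (its adjoint). -/
def FreeStarAlgebra (d : ℕ) : Type := MonoidAlgebra ℂ (FreeMonoid (Fin d × Bool))

namespace FreeStarAlgebra

variable {d : ℕ}

instance : Ring (FreeStarAlgebra d) :=
  inferInstanceAs (Ring (MonoidAlgebra ℂ (FreeMonoid (Fin d × Bool))))

instance : Algebra ℂ (FreeStarAlgebra d) :=
  inferInstanceAs (Algebra ℂ (MonoidAlgebra ℂ (FreeMonoid (Fin d × Bool))))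

/-- The letter `p`, as an element of the free star-algebra. -/
def letter (p : Fin d × Bool) : FreeStarAlgebra d :=
  MonoidAlgebra.of ℂ (FreeMonoid (Fin d × Bool)) (FreeMonoid.of p)

/-- The `i`-th free generator. -/
def gen (i : Fin d) : FreeStarAlgebra d := letter (i, false)

/-- The unital algebra map with prescribed values on the letters. -/
def liftAlg {B : Type*} [Ring B] [Algebra ℂ B] (g : Fin d × Bool → B) :
    FreeStarAlgebra d →ₐ[ℂ] B :=
  MonoidAlgebra.lift ℂ B (FreeMonoid (Fin d × Bool)) (FreeMonoid.lift g)

theorem liftAlg_letter {B : Type*} [Ring B] [Algebra ℂ B] (g : Fin d × Bool → B)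
    (p : Fin d × Bool) : liftAlg g (letter p) = g p := by
  unfold liftAlg letter
  erw [MonoidAlgebra.lift_of]
  simp

theorem ringHom_ext {B : Type*} [Ring B] {f g : FreeStarAlgebra d →+* B}
    (hc : ∀ c : ℂ, f (algebraMap ℂ _ c) = g (algebraMap ℂ _ c))
    (hl : ∀ p, f (letter p) = g (letter p)) : f = g := by
  apply MonoidAlgebra.ringHom_ext'
  · ext c
    exact hc c
  · apply FreeMonoid.hom_eq
    exact hl

theorem induction {motive : FreeStarAlgebra d → Prop}
    (hc : ∀ c : ℂ, motive (algebraMap ℂ _ c)) (hl : ∀ p, motive (letter p))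
    (hadd : ∀ x y, motive x → motive y → motive (x + y))
    (hmul : ∀ x y, motive x → motive y → motive (x * y)) (x : FreeStarAlgebra d) : motive x := by
  refine MonoidAlgebra.induction_on (motive := motive) x ?_ hadd ?_
  · intro w
    induction w using FreeMonoid.inductionOn' with
    | one => simpa using! hc 1
    | of_mul p w ih => rw [map_mul]; exact hmul _ _ (hl p) ih
  · intro r y hy
    rw [Algebra.smul_def]
    exact hmul _ _ (hc r) hy

/-- The involution as a ring homomorphism to the opposite ring: it conjugates scalars, reverses
words and exchanges each generator with its adjoint. -/
def starAux : FreeStarAlgebra d →+* (FreeStarAlgebra d)ᵐᵒᵖ :=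
  MonoidAlgebra.liftNCRingHom
    ((algebraMap ℂ (FreeStarAlgebra d)ᵐᵒᵖ).comp (starRingEnd ℂ))
    (FreeMonoid.lift fun p => MulOpposite.op (letter (p.1, !p.2)))
    (fun c _ => Algebra.commutes (starRingEnd ℂ c) _)

theorem starAux_letter (p : Fin d × Bool) :
    starAux (letter p) = MulOpposite.op (letter (p.1, !p.2)) := by
  unfold starAux
  refine (MonoidAlgebra.liftNCRingHom_single _ _ _ _ _).trans ?_
  simp

theorem starAux_algebraMap (c : ℂ) :
    starAux (algebraMap ℂ (FreeStarAlgebra d) c) = algebraMap ℂ _ (starRingEnd ℂ c) := by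
  unfold starAux
  refine (MonoidAlgebra.liftNCRingHom_single _ _ _ 1 c).trans ?_
  simp

instance : StarRing (FreeStarAlgebra d) where
  star x := (starAux x).unop
  star_involutive x := by
    induction x using induction with
    | hc c => simp [starAux_algebraMap, MulOpposite.algebraMap_apply]
    | hl p => simp [starAux_letter]
    | hadd x y hx hy => simp [hx, hy]
    | hmul x y hx hy => simp [hx, hy]
  star_mul x y := by simp
  star_add x y := by simp

theorem star_letter (p : Fin d × Bool) : star (letter p) = letter (p.1, !p.2) :=
  congrArg MulOpposite.unop (starAux_letter p)

theorem star_algebraMap (c : ℂ) :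
    star (algebraMap ℂ (FreeStarAlgebra d) c) = algebraMap ℂ _ (star c) :=
  congrArg MulOpposite.unop (starAux_algebraMap c)

instance : StarModule ℂ (FreeStarAlgebra d) where
  star_smul c x := by
    rw [Algebra.smul_def, star_mul, star_algebraMap, Algebra.smul_def, Algebra.commutes]

/-- The unital star-algebra map sending the `i`-th generator to `t i`. -/
def lift {B : Type*} [Ring B] [StarRing B] [Algebra ℂ B] [StarModule ℂ B] (t : Fin d → B) :
    FreeStarAlgebra d →⋆ₐ[ℂ] B where
  __ := liftAlg fun p => if p.2 then star (t p.1) else t p.1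
  map_star' x := by
    change liftAlg _ (star x) = star (liftAlg _ x)
    induction x using induction with
    | hc c =>
      rw [star_algebraMap, AlgHom.commutes, AlgHom.commutes, algebraMap_star_comm]
    | hl p => rcases p with ⟨i, _ | _⟩ <;> simp [star_letter, liftAlg_letter]
    | hadd x y hx hy => simp only [star_add, map_add, hx, hy]
    | hmul x y hx hy => simp only [star_mul, map_mul, hx, hy]

theorem lift_gen {B : Type*} [Ring B] [StarRing B] [Algebra ℂ B] [StarModule ℂ B]
    (t : Fin d → B) (i : Fin d) : lift t (gen i) = t i :=
  (liftAlg_letter _ _).trans (by simp)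

end FreeStarAlgebra

variable {d : ℕ}

/-! ### The universal C*-algebra of the Cuntz–Krieger relations -/

/-- A C*-seminorm on the free star-algebra that vanishes on the Cuntz–Krieger relations for `A`. -/
structure IsCKSeminorm (A : Matrix (Fin d) (Fin d) ℕ) (q : Seminorm ℂ (FreeStarAlgebra d)) :
    Prop where
  mul_le : ∀ x y, q (x * y) ≤ q x * q y
  star_mul_self : ∀ x, q (star x * x) = q x ^ 2
  partial_isometry : ∀ i, q (FreeStarAlgebra.gen i * star (FreeStarAlgebra.gen i) *
    FreeStarAlgebra.gen i - FreeStarAlgebra.gen i) = 0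
  sum_range : q (∑ i, FreeStarAlgebra.gen i * star (FreeStarAlgebra.gen i) - 1) = 0
  source : ∀ i, q (star (FreeStarAlgebra.gen i) * FreeStarAlgebra.gen i -
    ∑ j, A i j • (FreeStarAlgebra.gen j * star (FreeStarAlgebra.gen j))) = 0

namespace IsCKSeminorm
variable {A : Matrix (Fin d) (Fin d) ℕ} {q : Seminorm ℂ (FreeStarAlgebra d)}

theorem star_eq (h : IsCKSeminorm A q) (x : FreeStarAlgebra d) : q (star x) = q x := by
  have key : ∀ y, q y ≤ q (star y) := by
    intro y
    by_cases hy : q y = 0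
    · rw [hy]; exact apply_nonneg q _
    · have h1 := h.mul_le (star y) y
      rw [h.star_mul_self, sq] at h1
      exact le_of_mul_le_mul_right h1 (lt_of_le_of_ne (apply_nonneg q _) (Ne.symm hy))
  exact le_antisymm (by simpa using key (star x)) (key x)

theorem one_le (h : IsCKSeminorm A q) : q 1 ≤ 1 := by
  have := h.star_mul_self 1
  simp only [star_one, mul_one] at this
  nlinarith [sq_nonneg (q 1 - 1)]

theorem congr {x y : FreeStarAlgebra d} (hxy : q (x - y) = 0) : q x = q y := by
  refine le_antisymm ?_ ?_
  · have := map_add_le_add q (x - y) y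
    rw [sub_add_cancel] at this; linarith
  · have := map_add_le_add q (y - x) x
    rw [sub_add_cancel, map_sub_rev] at this; linarith

theorem gen_le (h : IsCKSeminorm A q) (i : Fin d) : q (FreeStarAlgebra.gen i) ≤ 1 := by
  set s := FreeStarAlgebra.gen i
  have h1 : q ((star s * s) * (star s * s)) = q (star s * s) := by
    apply congr
    have h2 : q (star s * (s * star s * s - s)) ≤ 0 := by
      refine (h.mul_le _ _).trans ?_
      rw [h.partial_isometry, mul_zero]
    refine le_antisymm ?_ (apply_nonneg q _)
    have e : star s * s * (star s * s) - star s * s = star s * (s * star s * s - s) := by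
      noncomm_ring
    rw [e]
    exact h2
  have h3 := h.star_mul_self (star s * s)
  rw [star_mul, star_star, h1, h.star_mul_self] at h3
  have h0 : 0 ≤ q s := apply_nonneg q _
  by_contra! hlt
  nlinarith [mul_pos (mul_pos (lt_trans one_pos hlt) (lt_trans one_pos hlt)) (by nlinarith : 0 < q s ^ 2 - 1)]

theorem zero : IsCKSeminorm A (0 : Seminorm ℂ (FreeStarAlgebra d)) := by
  constructor <;> intros <;> simp

end IsCKSeminorm

theorem exists_bound (A : Matrix (Fin d) (Fin d) ℕ) (x : FreeStarAlgebra d) :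
    ∃ C : ℝ, ∀ q, IsCKSeminorm A q → q x ≤ C := by
  induction x using FreeStarAlgebra.induction with
  | hc c =>
    refine ⟨‖c‖, fun q hq => ?_⟩
    rw [Algebra.algebraMap_eq_smul_one, map_smul_eq_mul]
    exact mul_le_of_le_one_right (norm_nonneg _) hq.one_le
  | hl p =>
    refine ⟨1, fun q hq => ?_⟩
    rcases p with ⟨i, _ | _⟩
    · exact hq.gen_le i
    · have := hq.gen_le i
      rw [← hq.star_eq] at this
      exact (congrArg q (FreeStarAlgebra.star_letter (i, false))).symm.le.trans this
  | hadd x y hx hy =>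
    obtain ⟨C, hC⟩ := hx
    obtain ⟨D, hD⟩ := hy
    exact ⟨C + D, fun q hq => (map_add_le_add q x y).trans (add_le_add (hC q hq) (hD q hq))⟩
  | hmul x y hx hy =>
    obtain ⟨C, hC⟩ := hx
    obtain ⟨D, hD⟩ := hy
    exact ⟨C * D, fun q hq => (hq.mul_le x y).trans
      (mul_le_mul (hC q hq) (hD q hq) (apply_nonneg q _) ((apply_nonneg q _).trans (hC q hq)))⟩

/-- The largest C*-seminorm on the free star-algebra that vanishes on the Cuntz–Krieger
relations for `A`. -/
def ckSeminorm (A : Matrix (Fin d) (Fin d) ℕ) : Seminorm ℂ (FreeStarAlgebra d) :=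
  ⨆ q : {q : Seminorm ℂ (FreeStarAlgebra d) // IsCKSeminorm A q}, q.1

section
variable (A : Matrix (Fin d) (Fin d) ℕ)

theorem bddAbove_apply (x : FreeStarAlgebra d) :
    BddAbove (Set.range fun q : {q : Seminorm ℂ (FreeStarAlgebra d) // IsCKSeminorm A q} =>
      q.1 x) := by
  obtain ⟨C, hC⟩ := exists_bound A x
  exact ⟨C, by rintro _ ⟨q, rfl⟩; exact hC q.1 q.2⟩

theorem ckSeminorm_apply (x : FreeStarAlgebra d) : ckSeminorm A x =
    ⨆ q : {q : Seminorm ℂ (FreeStarAlgebra d) // IsCKSeminorm A q}, q.1 x :=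
  Seminorm.iSup_apply (Seminorm.bddAbove_range_iff.2 (bddAbove_apply A))

instance : Nonempty {q : Seminorm ℂ (FreeStarAlgebra d) // IsCKSeminorm A q} :=
  ⟨⟨0, IsCKSeminorm.zero⟩⟩

theorem le_ckSeminorm {q : Seminorm ℂ (FreeStarAlgebra d)} (hq : IsCKSeminorm A q)
    (x : FreeStarAlgebra d) : q x ≤ ckSeminorm A x := by
  rw [ckSeminorm_apply]
  exact le_ciSup (bddAbove_apply A x) ⟨q, hq⟩

theorem ckSeminorm_le {x : FreeStarAlgebra d} {C : ℝ} (h : ∀ q, IsCKSeminorm A q → q x ≤ C) :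
    ckSeminorm A x ≤ C := by
  rw [ckSeminorm_apply]
  exact ciSup_le fun q => h q.1 q.2

theorem isCKSeminorm_ckSeminorm : IsCKSeminorm A (ckSeminorm A) where
  mul_le x y := ckSeminorm_le A fun q hq => (hq.mul_le x y).trans
    (mul_le_mul (le_ckSeminorm A hq x) (le_ckSeminorm A hq y) (apply_nonneg q _)
      (apply_nonneg (ckSeminorm A) _))
  star_mul_self x := by
    refine le_antisymm ?_ ?_
    · refine ckSeminorm_le A fun q hq => ?_
      rw [hq.star_mul_self]
      exact pow_le_pow_left₀ (apply_nonneg q _) (le_ckSeminorm A hq x) 2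
    · have h : ckSeminorm A x ≤ √(ckSeminorm A (star x * x)) := by
        refine ckSeminorm_le A fun q hq => Real.le_sqrt_of_sq_le ?_
        rw [← hq.star_mul_self]
        exact le_ckSeminorm A hq _
      exact (Real.le_sqrt (apply_nonneg (ckSeminorm A) _) (apply_nonneg (ckSeminorm A) _)).1 h
  partial_isometry i := le_antisymm
    (ckSeminorm_le A fun _ hq => (hq.partial_isometry i).le) (apply_nonneg (ckSeminorm A) _)
  sum_range := le_antisymm
    (ckSeminorm_le A fun _ hq => hq.sum_range.le) (apply_nonneg (ckSeminorm A) _)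
  source i := le_antisymm
    (ckSeminorm_le A fun _ hq => (hq.source i).le) (apply_nonneg (ckSeminorm A) _)

end

/-- The free star-algebra, equipped with the seminorm `ckSeminorm A`. -/
def PreCK (_A : Matrix (Fin d) (Fin d) ℕ) : Type := FreeStarAlgebra d

section
variable (A : Matrix (Fin d) (Fin d) ℕ)

instance : Ring (PreCK A) := inferInstanceAs (Ring (FreeStarAlgebra d))
instance : Algebra ℂ (PreCK A) := inferInstanceAs (Algebra ℂ (FreeStarAlgebra d))
instance : StarRing (PreCK A) := inferInstanceAs (StarRing (FreeStarAlgebra d))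
instance : StarModule ℂ (PreCK A) := inferInstanceAs (StarModule ℂ (FreeStarAlgebra d))

instance : SeminormedRing (PreCK A) where
  __ := (inferInstance : Ring (PreCK A))
  __ := (ckSeminorm A).toAddGroupSeminorm.toSeminormedAddCommGroup
  norm_mul_le := (isCKSeminorm_ckSeminorm A).mul_le

theorem PreCK.norm_def (x : PreCK A) : ‖x‖ = ckSeminorm A x := rfl

instance : NormedAlgebra ℂ (PreCK A) where
  norm_smul_le c x := (map_smul_eq_mul (ckSeminorm A) c x).le

instance : NormedStarGroup (PreCK A) where
  norm_star_le x := ((isCKSeminorm_ckSeminorm A).star_eq x).le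

/-- The Cuntz–Krieger algebra `O_A`: the universal C*-algebra generated by a Cuntz–Krieger family
for `A`, i.e. the Hausdorff completion of the free star-algebra in the largest C*-seminorm
vanishing on the relations. It has the universal property `CKAlgebra.lift`, `CKAlgebra.hom_ext`
with respect to all C*-algebras. -/
def CKAlgebra : Type := UniformSpace.Completion (PreCK A)

namespace CKAlgebra

instance : NormedRing (CKAlgebra A) :=
  inferInstanceAs (NormedRing (UniformSpace.Completion (PreCK A)))

instance : CompleteSpace (CKAlgebra A) :=
  inferInstanceAs (CompleteSpace (UniformSpace.Completion (PreCK A)))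

instance : NormedAlgebra ℂ (CKAlgebra A) where
  __ := (inferInstance : Algebra ℂ (UniformSpace.Completion (PreCK A)))
  norm_smul_le := norm_smul_le (α := ℂ) (β := UniformSpace.Completion (PreCK A))

/-- The canonical map with dense range. -/
def of : PreCK A →ₐ[ℂ] CKAlgebra A where
  __ := (UniformSpace.Completion.coeRingHom : PreCK A →+* UniformSpace.Completion (PreCK A))
  commutes' _ := rfl

theorem norm_of (x : PreCK A) : ‖of A x‖ = ‖x‖ := UniformSpace.Completion.norm_coe x

theorem continuous_of : Continuous (of A) := UniformSpace.Completion.continuous_coe (PreCK A)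

theorem denseRange_of : DenseRange (of A) := UniformSpace.Completion.denseRange_coe

theorem uniformContinuous_star : UniformContinuous (star : PreCK A → PreCK A) :=
  uniformContinuous_addMonoidHom_of_continuous
    (f := (starAddEquiv : PreCK A ≃+ PreCK A).toAddMonoidHom) continuous_star

instance : Star (CKAlgebra A) :=
  ⟨UniformSpace.Completion.map (star : PreCK A → PreCK A)⟩

theorem star_of (x : PreCK A) : star (of A x) = of A (star x) :=
  UniformSpace.Completion.map_coe (uniformContinuous_star A) x

theorem continuous_star' : Continuous (star : CKAlgebra A → CKAlgebra A) :=
  UniformSpace.Completion.continuous_map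

instance : StarRing (CKAlgebra A) where
  star_involutive x := by
    refine (denseRange_of A).induction_on (p := fun x => star (star x) = x) x
      (isClosed_eq ((continuous_star' A).comp (continuous_star' A)) continuous_id) ?_
    intro y
    rw [star_of, star_of, star_star]
  star_mul x y := by
    refine (denseRange_of A).induction_on₂ (p := fun x y => star (x * y) = star y * star x)
      (isClosed_eq ((continuous_star' A).comp continuous_mul)
        (((continuous_star' A).comp continuous_snd).mul ((continuous_star' A).comp continuous_fst)))
      ?_ x y
    intro a b
    simp only [← map_mul, star_of, star_mul]
  star_add x y := by
    refine (denseRange_of A).induction_on₂ (p := fun x y => star (x + y) = star x + star y)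
      (isClosed_eq ((continuous_star' A).comp continuous_add)
        (((continuous_star' A).comp continuous_fst).add ((continuous_star' A).comp continuous_snd)))
      ?_ x y
    intro a b
    simp only [← map_add, star_of, star_add]

instance : CStarAlgebra (CKAlgebra A) where
  norm_mul_self_le x := by
    refine (denseRange_of A).induction_on (p := fun x => ‖x‖ * ‖x‖ ≤ ‖star x * x‖) x
      (isClosed_le (by fun_prop) (((continuous_star' A).mul continuous_id).norm)) ?_
    intro y
    rw [star_of, ← map_mul, norm_of, norm_of, PreCK.norm_def, PreCK.norm_def, ← sq]
    exact ((isCKSeminorm_ckSeminorm A).star_mul_self y).ge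
  star_smul c x := by
    refine (denseRange_of A).induction_on (p := fun x => star (c • x) = star c • star x) x
      (isClosed_eq ((continuous_star' A).comp (continuous_const_smul c))
        ((continuous_star' A).const_smul (star c))) ?_
    intro y
    simp only [← map_smul, star_of, star_smul]

/-- The image of a free generator in the seminormed star-algebra. -/
def preGen (i : Fin d) : PreCK A := FreeStarAlgebra.gen i

/-- The canonical generators `s i` of `O_A`. -/
def s (i : Fin d) : CKAlgebra A := of A (preGen A i)

theorem of_eq_of {x y : PreCK A} (h : ckSeminorm A (x - y : PreCK A) = 0) : of A x = of A y := by
  rw [← sub_eq_zero, ← map_sub, ← norm_eq_zero, norm_of]; exact h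

theorem isCKFamily_s : IsCKFamily A (s A) where
  partial_isometry i := by
    simp only [s, star_of, ← map_mul]
    exact of_eq_of A ((isCKSeminorm_ckSeminorm A).partial_isometry i)
  sum_range := by
    simp only [s, star_of, ← map_mul, ← map_sum, ← map_one (of A)]
    exact of_eq_of A (isCKSeminorm_ckSeminorm A).sum_range
  source i := by
    simp only [s, star_of, ← map_mul, ← map_nsmul, ← map_sum]
    exact of_eq_of A ((isCKSeminorm_ckSeminorm A).source i)

variable {A}

/-- The map on the free star-algebra induced by a family. -/
def preLift {B : Type*} [CStarAlgebra B] (t : Fin d → B) : PreCK A →⋆ₐ[ℂ] B :=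
  FreeStarAlgebra.lift t

theorem norm_preLift_le {B : Type*} [CStarAlgebra B] {t : Fin d → B} (ht : IsCKFamily A t)
    (x : PreCK A) : ‖preLift t x‖ ≤ ‖x‖ := by
  have hs : ∀ i, FreeStarAlgebra.lift t (star (FreeStarAlgebra.gen i)) = star (t i) := fun i =>
    (map_star (FreeStarAlgebra.lift t) _).trans (congrArg star (FreeStarAlgebra.lift_gen t i))
  have h : IsCKSeminorm A
      ((normSeminorm ℂ B).comp (FreeStarAlgebra.lift t).toAlgHom.toLinearMap) := by
    constructor
    · intro x y
      change ‖FreeStarAlgebra.lift t (x * y)‖ ≤ ‖FreeStarAlgebra.lift t x‖ * _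
      rw [map_mul]; exact norm_mul_le _ _
    · intro x
      change ‖FreeStarAlgebra.lift t (star x * x)‖ = ‖FreeStarAlgebra.lift t x‖ ^ 2
      rw [map_mul, map_star, CStarRing.norm_star_mul_self, sq]
    · intro i
      change ‖FreeStarAlgebra.lift t _‖ = 0
      simp [FreeStarAlgebra.lift_gen, hs, ht.partial_isometry]
    · change ‖FreeStarAlgebra.lift t _‖ = 0
      simp [FreeStarAlgebra.lift_gen, hs, ht.sum_range]
    · intro i
      change ‖FreeStarAlgebra.lift t _‖ = 0
      simp [FreeStarAlgebra.lift_gen, hs, ht.source]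
  exact le_ckSeminorm A h x

theorem continuous_preLift {B : Type*} [CStarAlgebra B] {t : Fin d → B} (ht : IsCKFamily A t) :
    Continuous (preLift t : PreCK A →⋆ₐ[ℂ] B) :=
  AddMonoidHomClass.continuous_of_bound (preLift t : PreCK A →⋆ₐ[ℂ] B) 1
    fun x => by rw [one_mul]; exact norm_preLift_le ht x

/-- The extension of `preLift` to the completion. -/
def liftRingHom {B : Type*} [CStarAlgebra B] {t : Fin d → B} (ht : IsCKFamily A t) :
    CKAlgebra A →+* B :=
  UniformSpace.Completion.extensionHom
    (preLift t : PreCK A →⋆ₐ[ℂ] B).toAlgHom.toRingHom (continuous_preLift ht)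

theorem liftRingHom_of {B : Type*} [CStarAlgebra B] {t : Fin d → B} (ht : IsCKFamily A t)
    (x : PreCK A) : liftRingHom ht (of A x) = preLift t x :=
  UniformSpace.Completion.extensionHom_coe _ (continuous_preLift ht) x

theorem continuous_liftRingHom {B : Type*} [CStarAlgebra B] {t : Fin d → B}
    (ht : IsCKFamily A t) : Continuous (liftRingHom ht) :=
  UniformSpace.Completion.continuous_extension

/-- The universal property of `O_A`: a Cuntz–Krieger family in a C*-algebra `B` (in any universe)
induces a star-homomorphism `O_A → B`. -/
def lift {B : Type*} [CStarAlgebra B] {t : Fin d → B} (ht : IsCKFamily A t) :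
    CKAlgebra A →⋆ₐ[ℂ] B where
  __ := liftRingHom ht
  commutes' c := (liftRingHom_of ht (algebraMap ℂ (PreCK A) c)).trans
    (AlgHomClass.commutes (preLift t : PreCK A →⋆ₐ[ℂ] B) c)
  map_star' x := by
    refine (denseRange_of A).induction_on
      (p := fun x => liftRingHom ht (star x) = star (liftRingHom ht x)) x
      (isClosed_eq ((continuous_liftRingHom ht).comp (continuous_star' A))
        (continuous_liftRingHom ht).star) ?_
    intro y
    rw [star_of, liftRingHom_of, liftRingHom_of, map_star]

/-- The induced star-homomorphism sends `s i` to `t i`. -/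
theorem lift_s {B : Type*} [CStarAlgebra B] {t : Fin d → B} (ht : IsCKFamily A t) (i : Fin d) :
    lift ht (s A i) = t i :=
  (liftRingHom_of ht (FreeStarAlgebra.gen i)).trans (FreeStarAlgebra.lift_gen t i)

open scoped CStarAlgebra in
/-- Star-homomorphisms on `O_A` are determined by their values on the generators. -/
theorem hom_ext {B : Type*} [CStarAlgebra B] {f g : CKAlgebra A →⋆ₐ[ℂ] B}
    (h : ∀ i, f (s A i) = g (s A i)) : f = g := by
  have hof : ∀ x : PreCK A, f (of A x) = g (of A x) := by
    intro x
    induction x using FreeStarAlgebra.induction with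
    | hc c => exact (congrArg f ((of A).commutes c)).trans ((AlgHomClass.commutes f c).trans
        ((congrArg g ((of A).commutes c)).trans (AlgHomClass.commutes g c)).symm)
    | hl p =>
      rcases p with ⟨i, _ | _⟩
      · exact h i
      · have e : of A (FreeStarAlgebra.letter (i, true)) = star (s A i) :=
          (congrArg (of A) (FreeStarAlgebra.star_letter (i, false)).symm).trans
            (star_of A _).symm
        rw [e, map_star, map_star, h i]
    | hadd x y hx hy =>
      have e : of A (x + y) = of A x + of A y := map_add (of A) x y
      exact (congrArg f e).trans (by rw [map_add, hx, hy, ← map_add, ← e])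
    | hmul x y hx hy =>
      have e : of A (x * y) = of A x * of A y := map_mul (of A) x y
      exact (congrArg f e).trans (by rw [map_mul, hx, hy, ← map_mul, ← e])
  have hf : Continuous f := map_continuous f
  have hg : Continuous g := map_continuous g
  ext x
  exact congrFun ((denseRange_of A).equalizer hf hg (funext hof)) x

end CKAlgebra
end

/-! ### The subshift and the diagonal subalgebra -/

/-- The one-sided Markov subshift `Λ_A` (coordinates indexed from `0`), with the subspace topology
and the subspace σ-algebra of the product; the latter is the Borel σ-algebra. -/
abbrev Subshift (A : Matrix (Fin d) (Fin d) ℕ) : Type :=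
  {x : ℕ → Fin d // ∀ n, A (x n) (x (n + 1)) = 1}

namespace CKAlgebra

section
variable (A : Matrix (Fin d) (Fin d) ℕ)

theorem star_s_mul_s_of_ne {i j : Fin d} (hij : i ≠ j) : star (s A i) * s A j = 0 := by
  let _ := CStarAlgebra.spectralOrder (CKAlgebra A)
  have _ := CStarAlgebra.spectralOrderedRing (CKAlgebra A)
  have hs := isCKFamily_s A
  set p : Fin d → CKAlgebra A := fun i => s A i * star (s A i) with hp
  have hpp : ∀ k, p k * p k = p k := fun k => by
    simp only [hp]
    rw [← mul_assoc, hs.partial_isometry]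
  have hps : ∀ k, star (p k) = p k := fun k => by simp [hp]
  have hsq : ∀ k, p j * p k * p j = star (p k * p j) * (p k * p j) := fun k => by
    rw [star_mul, hps, hps, mul_assoc (p j) (p k) (p k * p j), ← mul_assoc (p k) (p k) (p j),
      hpp, mul_assoc (p j) (p k) (p j)]
  have hsum : ∑ k, p j * p k * p j = p j := by
    rw [← Finset.sum_mul, ← Finset.mul_sum, hs.sum_range, mul_one, hpp]
  have h0 : ∑ k ∈ Finset.univ.erase j, p j * p k * p j = 0 := by
    rw [← Finset.add_sum_erase _ _ (Finset.mem_univ j), hpp, hpp] at hsum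
    exact add_eq_left.mp hsum
  have h1 := (Finset.sum_eq_zero_iff_of_nonneg (fun k _ => by
    rw [hsq]; exact star_mul_self_nonneg _)).1 h0 i (Finset.mem_erase.2 ⟨hij, Finset.mem_univ i⟩)
  rw [hsq, CStarRing.star_mul_self_eq_zero_iff] at h1
  have h2 : star (s A i) = star (s A i) * p i := by
    have := congrArg star (hs.partial_isometry i)
    simpa [hp, mul_assoc] using this.symm
  have h3 : s A j = p j * s A j := (hs.partial_isometry j).symm
  rw [h2, h3, mul_assoc, ← mul_assoc (p i), h1, zero_mul, mul_zero]

/-- `s w = s w₁ ⋯ s wᵣ` for a word `w`. -/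
def word (w : List (Fin d)) : CKAlgebra A := (w.map (s A)).prod

/-- The range projection `s w (s w)*` for a word `w`. -/
def wordProj (w : List (Fin d)) : CKAlgebra A := word A w * star (word A w)

theorem wordProj_nil : wordProj A [] = 1 := by simp [wordProj, word]

theorem wordProj_cons (i : Fin d) (w : List (Fin d)) :
    wordProj A (i :: w) = s A i * wordProj A w * star (s A i) := by
  simp [wordProj, word, mul_assoc]

theorem wordProj_singleton (i : Fin d) : wordProj A [i] = s A i * star (s A i) := by
  simp [wordProj, word]

theorem star_wordProj (w : List (Fin d)) : star (wordProj A w) = wordProj A w := by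
  simp [wordProj]

theorem source_eq (i : Fin d) :
    star (s A i) * s A i = ∑ j, A i j • wordProj A [j] := by
  simp only [wordProj_singleton]
  exact (isCKFamily_s A).source i

theorem singleton_mul_cons (j i : Fin d) (w : List (Fin d)) :
    wordProj A [j] * wordProj A (i :: w) = if j = i then wordProj A (i :: w) else 0 := by
  rw [wordProj_singleton, wordProj_cons]
  split_ifs with h
  · subst h
    rw [← mul_assoc, ← mul_assoc, (isCKFamily_s A).partial_isometry]
  · rw [mul_assoc, ← mul_assoc (star _), ← mul_assoc (star _), star_s_mul_s_of_ne A h]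
    simp

theorem commute_singleton (j : Fin d) (w : List (Fin d)) :
    Commute (wordProj A [j]) (wordProj A w) := by
  rcases w with _ | ⟨i, w⟩
  · rw [wordProj_nil]; exact Commute.one_right _
  · have h := singleton_mul_cons A j i w
    have h' := congrArg star h
    rw [star_mul, star_wordProj, star_wordProj] at h'
    rw [Commute, SemiconjBy, h, h']
    split_ifs <;> simp [star_wordProj]

theorem commute_source (i : Fin d) (w : List (Fin d)) :
    Commute (star (s A i) * s A i) (wordProj A w) := by
  rw [source_eq]
  exact Commute.sum_left _ _ _ fun j _ => (commute_singleton A j w).smul_left _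

theorem cons_mul_cons (i : Fin d) (v w : List (Fin d)) :
    wordProj A (i :: v) * wordProj A (i :: w) =
      s A i * (wordProj A v * wordProj A w) * star (s A i) := by
  have h := (commute_source A i v).eq
  calc wordProj A (i :: v) * wordProj A (i :: w)
      = s A i * (wordProj A v * (star (s A i) * s A i)) * wordProj A w * star (s A i) := by
        simp only [wordProj_cons, mul_assoc]
    _ = (s A i * star (s A i) * s A i) * wordProj A v * wordProj A w * star (s A i) := by
        rw [← h]; simp only [mul_assoc]
    _ = _ := by rw [(isCKFamily_s A).partial_isometry]; simp only [mul_assoc]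

theorem cons_mul_cons_of_ne {i j : Fin d} (hij : i ≠ j) (v w : List (Fin d)) :
    wordProj A (i :: v) * wordProj A (j :: w) = 0 := by
  rw [wordProj_cons, wordProj_cons]
  calc _ = s A i * wordProj A v * (star (s A i) * s A j) * wordProj A w * star (s A j) := by
        simp only [mul_assoc]
    _ = 0 := by rw [star_s_mul_s_of_ne A hij]; simp

theorem commute_wordProj (v w : List (Fin d)) : Commute (wordProj A v) (wordProj A w) := by
  induction v generalizing w with
  | nil => rw [wordProj_nil]; exact Commute.one_left _
  | cons i v ih =>
    rcases w with _ | ⟨j, w⟩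
    · rw [wordProj_nil]; exact Commute.one_right _
    · by_cases hij : i = j
      · subst hij
        rw [Commute, SemiconjBy, cons_mul_cons, cons_mul_cons, (ih w).eq]
      · rw [Commute, SemiconjBy, cons_mul_cons_of_ne A hij, cons_mul_cons_of_ne A (Ne.symm hij)]

theorem wordProj_mul_self (w : List (Fin d)) : wordProj A w * wordProj A w = wordProj A w := by
  induction w with
  | nil => simp [wordProj_nil]
  | cons i w ih => rw [cons_mul_cons, ih, ← wordProj_cons]

theorem wordProj_mul_of_ne {v w : List (Fin d)} (hl : v.length = w.length) (h : v ≠ w) :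
    wordProj A v * wordProj A w = 0 := by
  induction v generalizing w with
  | nil => exact absurd (List.length_eq_zero_iff.1 hl.symm).symm h
  | cons i v ih =>
    rcases w with _ | ⟨j, w⟩
    · simp at hl
    · by_cases hij : i = j
      · subst hij
        rw [cons_mul_cons, ih (by simpa using hl) (by simpa using h)]
        simp
      · exact cons_mul_cons_of_ne A hij _ _

theorem sum_wordProj_append (w : List (Fin d)) :
    ∑ i, wordProj A (w ++ [i]) = wordProj A w := by
  induction w with
  | nil => simpa [wordProj_singleton, wordProj_nil] using (isCKFamily_s A).sum_range
  | cons j w ih =>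
    simp only [List.cons_append, wordProj_cons]
    rw [← Finset.sum_mul, ← Finset.mul_sum, ih]

theorem wordProj_append_pair (w : List (Fin d)) (i j : Fin d) :
    wordProj A (w ++ [i, j]) = A i j • wordProj A (w ++ [i, j]) := by
  induction w with
  | nil =>
    have h : s A i * wordProj A [j] = A i j • (s A i * wordProj A [j]) := by
      calc s A i * wordProj A [j] = s A i * ((star (s A i) * s A i) * wordProj A [j]) := by
            rw [← mul_assoc, ← mul_assoc, (isCKFamily_s A).partial_isometry]
        _ = s A i * (A i j • wordProj A [j]) := by
            rw [source_eq, Finset.sum_mul]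
            congr 1
            rw [Finset.sum_eq_single j]
            · rw [smul_mul_assoc, wordProj_mul_self]
            · intro k _ hk
              rw [smul_mul_assoc, singleton_mul_cons, if_neg hk, smul_zero]
            · simp
        _ = _ := by rw [mul_smul_comm]
    rw [List.nil_append, wordProj_cons, ← smul_mul_assoc, ← h]
  | cons k w ih =>
    rw [List.cons_append, wordProj_cons, ← smul_mul_assoc, ← mul_smul_comm, ← ih]

/-- The C*-subalgebra of `O_A` generated by the range projections of all words, i.e. the canonical
copy of `C(Λ_A)`. -/
def diagonal : StarSubalgebra ℂ (CKAlgebra A) :=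
  (StarAlgebra.adjoin ℂ (Set.range (wordProj A))).topologicalClosure

theorem wordProj_mem_diagonal (w : List (Fin d)) : wordProj A w ∈ diagonal A :=
  StarSubalgebra.le_topologicalClosure _ (StarAlgebra.subset_adjoin ℂ _ ⟨w, rfl⟩)

theorem isClosed_diagonal : IsClosed (diagonal A : Set (CKAlgebra A)) :=
  StarSubalgebra.isClosed_topologicalClosure _

theorem diagonal_mul_comm (x y : diagonal A) : x * y = y * x := by
  have h := StarSubalgebra.topologicalClosure_adjoin_le_centralizer_centralizer ℂ
    (Set.range (wordProj A))
  have hx := h x.2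
  have hy : (y : CKAlgebra A) ∈ StarSubalgebra.centralizer ℂ (Set.range (wordProj A)) := by
    have hle : diagonal A ≤ StarSubalgebra.centralizer ℂ (Set.range (wordProj A)) := by
      refine StarSubalgebra.topologicalClosure_minimal ?_ (Set.isClosed_centralizer _)
      rw [StarAlgebra.adjoin_le_iff]
      rintro _ ⟨v, rfl⟩
      rw [SetLike.mem_coe, StarSubalgebra.mem_centralizer_iff]
      rintro _ ⟨w, rfl⟩
      rw [star_wordProj]
      exact ⟨(commute_wordProj A w v).eq, (commute_wordProj A w v).eq⟩
    exact hle y.2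
  rw [StarSubalgebra.mem_centralizer_iff] at hx
  exact Subtype.ext (hx y hy).1.symm

instance : CommCStarAlgebra (diagonal A) :=
  haveI : IsClosed (diagonal A : Set (CKAlgebra A)) := isClosed_diagonal A
  { (inferInstance : CStarAlgebra (diagonal A)) with
    mul_comm := diagonal_mul_comm A }

/-- The range projection of a word as an element of the diagonal subalgebra. -/
def diagProj (w : List (Fin d)) : diagonal A := ⟨wordProj A w, wordProj_mem_diagonal A w⟩

end

end CKAlgebra

open WeakDual

/-- The word formed by the first `n` coordinates of `x`. -/
def initWord (x : ℕ → Fin d) (n : ℕ) : List (Fin d) := (List.range n).map x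

theorem length_initWord (x : ℕ → Fin d) (n : ℕ) : (initWord x n).length = n := by
  simp [initWord]

theorem initWord_succ (x : ℕ → Fin d) (n : ℕ) :
    initWord x (n + 1) = initWord x n ++ [x n] := by
  simp [initWord, List.range_succ]

namespace CKAlgebra

section
variable (A : Matrix (Fin d) (Fin d) ℕ)

theorem char_diagProj (φ : characterSpace ℂ (diagonal A)) (w : List (Fin d)) :
    φ (diagProj A w) = 0 ∨ φ (diagProj A w) = 1 := by
  have h : diagProj A w * diagProj A w = diagProj A w := Subtype.ext (wordProj_mul_self A w)
  have h' := congrArg φ h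
  rw [map_mul] at h'
  rcases eq_or_ne (φ (diagProj A w)) 0 with h0 | h0
  · exact Or.inl h0
  · exact Or.inr (mul_left_cancel₀ h0 (by rw [h', mul_one]))

theorem exists_next (φ : characterSpace ℂ (diagonal A)) (w : List (Fin d))
    (hw : φ (diagProj A w) = 1) : ∃ i, φ (diagProj A (w ++ [i])) = 1 := by
  by_contra! h
  have h0 : ∀ i, φ (diagProj A (w ++ [i])) = 0 := fun i =>
    (char_diagProj A φ _).resolve_right (h i)
  have e : diagProj A w = ∑ i, diagProj A (w ++ [i]) := by
    apply Subtype.ext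
    rw [AddSubmonoidClass.coe_finsetSum]
    exact (sum_wordProj_append A w).symm
  rw [e, map_sum] at hw
  simp [h0] at hw

theorem char_unique (φ : characterSpace ℂ (diagonal A)) {v w : List (Fin d)}
    (hl : v.length = w.length) (hv : φ (diagProj A v) = 1) (hw : φ (diagProj A w) = 1) :
    v = w := by
  by_contra h
  have e : diagProj A v * diagProj A w = 0 := Subtype.ext (wordProj_mul_of_ne A hl h)
  have := congrArg φ e
  rw [map_mul, hv, hw, map_zero] at this
  simp at this

theorem exists_point (φ : characterSpace ℂ (diagonal A)) :
    ∃ x : Subshift A, ∀ n, φ (diagProj A (initWord x.1 n)) = 1 := by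
  have hnil : φ (diagProj A []) = 1 := by
    have e : diagProj A [] = 1 := Subtype.ext (wordProj_nil A)
    rw [e, map_one]
  obtain ⟨i₀, _⟩ := exists_next A φ [] hnil
  have : Nonempty (Fin d) := ⟨i₀⟩
  choose! next hnext using exists_next A φ
  let W : ℕ → List (Fin d) := fun n => Nat.rec [] (fun _ w => w ++ [next w]) n
  have hW : ∀ n, φ (diagProj A (W n)) = 1 := by
    intro n
    induction n with
    | zero => exact hnil
    | succ n ih => exact hnext _ ih
  have hinit : ∀ n, initWord (fun k => next (W k)) n = W n := by
    intro n
    induction n with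
    | zero => rfl
    | succ n ih => rw [initWord_succ, ih]
  refine ⟨⟨fun k => next (W k), fun n => ?_⟩, fun n => ?_⟩
  · have h1 := hW (n + 2)
    have e : W (n + 2) = W n ++ [next (W n), next (W (n + 1))] := by
      change (W n ++ [next (W n)]) ++ [next (W (n + 1))] = _
      simp
    rw [e] at h1
    have e2 : diagProj A (W n ++ [next (W n), next (W (n + 1))]) =
        A (next (W n)) (next (W (n + 1))) •
          diagProj A (W n ++ [next (W n), next (W (n + 1))]) :=
      Subtype.ext (wordProj_append_pair A _ _ _)
    have h2 := congrArg φ e2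
    rw [map_nsmul, h1, nsmul_eq_mul, mul_one] at h2
    exact_mod_cast h2.symm
  · rw [hinit]; exact hW n

/-- The point of `Λ_A` attached to a character `φ` of the diagonal subalgebra: the one whose
initial words `w` all satisfy `φ (s w (s w)*) = 1`. -/
def charPoint (φ : characterSpace ℂ (diagonal A)) : Subshift A := (exists_point A φ).choose

theorem char_eq_one_iff (φ : characterSpace ℂ (diagonal A)) (w : List (Fin d)) :
    φ (diagProj A w) = 1 ↔ initWord (charPoint A φ).1 w.length = w := by
  have h := (exists_point A φ).choose_spec w.length
  refine ⟨fun hw => char_unique A φ (length_initWord _ _) h hw, fun hw => ?_⟩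
  rw [← hw]; simpa [length_initWord] using! h

theorem continuous_charPoint : Continuous (charPoint A) := by
  refine continuous_induced_rng.2 (continuous_pi fun n => ?_)
  change Continuous fun φ => (charPoint A φ).1 n
  rw [continuous_discrete_rng]
  intro i
  have e : (fun φ => (charPoint A φ).1 n) ⁻¹' {i} =
      ⋃ w ∈ {w : List (Fin d) | w.length = n},
        {φ : characterSpace ℂ (diagonal A) | φ (diagProj A (w ++ [i])) ≠ 0} := by
    ext φ
    simp only [Set.mem_preimage, Set.mem_singleton_iff, Set.mem_iUnion, Set.mem_ofPred_eq,
      exists_prop]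
    constructor
    · intro h
      refine ⟨initWord (charPoint A φ).1 n, length_initWord _ _, ?_⟩
      rw [(char_eq_one_iff A φ _).2]
      · exact one_ne_zero
      · rw [List.length_append, length_initWord, List.length_singleton, initWord_succ, h]
    · rintro ⟨w, hw, h⟩
      have h1 := (char_eq_one_iff A φ _).1 ((char_diagProj A φ _).resolve_left h)
      rw [List.length_append, List.length_singleton, initWord_succ] at h1
      have h2 := (List.append_inj' h1 rfl).2
      rw [hw] at h2
      simpa using h2
  rw [e]
  refine isOpen_biUnion fun w _ => ?_
  exact isOpen_ne_fun (gelfandTransform ℂ (diagonal A) (diagProj A (w ++ [i]))).continuous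
    continuous_const

/-- `charPoint` as a continuous map. -/
def charMap : C(characterSpace ℂ (diagonal A), Subshift A) :=
  ⟨charPoint A, continuous_charPoint A⟩

/-- The canonical unital star-homomorphism of `C(Λ_A)` into `O_A`. It is the one that sends the
indicator function of the cylinder `[w]` to `s w (s w)*` for each word `w`, see
`diagEmbedding_cylinderIndicator`; indicators of cylinders span a dense subspace, so this
determines it. It is built here by Gelfand duality for the diagonal subalgebra. -/
def diagEmbedding : C(Subshift A, ℂ) →⋆ₐ[ℂ] CKAlgebra A :=
  (diagonal A).subtype.comp
    (((gelfandStarTransform (diagonal A)).symm :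
        C(characterSpace ℂ (diagonal A), ℂ) →⋆ₐ[ℂ] diagonal A).comp
      (ContinuousMap.compStarAlgHom' ℂ ℂ (charMap A)))

theorem diagEmbedding_mem (f : C(Subshift A, ℂ)) : diagEmbedding A f ∈ diagonal A :=
  Subtype.property _

/-- The indicator function of the cylinder `[w] = {x | x begins with w}`. -/
def cylinderIndicator (w : List (Fin d)) : C(Subshift A, ℂ) where
  toFun x := if initWord x.1 w.length = w then 1 else 0
  continuous_toFun := by
    have h : Continuous fun x : Subshift A => fun k : Fin w.length => x.1 k :=
      continuous_pi fun k => (continuous_apply _).comp continuous_subtype_val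
    have h2 : Continuous fun y : Fin w.length → Fin d =>
        if List.ofFn y = w then (1 : ℂ) else 0 := continuous_of_discreteTopology
    convert h2.comp h using 2 with x
    have e : initWord x.1 w.length = List.ofFn fun k : Fin w.length => x.1 k := by
      apply List.ext_getElem <;> simp [initWord]
    rw [e]
    rfl

theorem diagEmbedding_cylinderIndicator (w : List (Fin d)) :
    diagEmbedding A (cylinderIndicator A w) = wordProj A w := by
  have h : (cylinderIndicator A w).comp (charMap A) =
      gelfandStarTransform (diagonal A) (diagProj A w) := by
    ext φ
    change (if initWord (charPoint A φ).1 w.length = w then (1 : ℂ) else 0) = φ (diagProj A w)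
    split_ifs with hw
    · exact ((char_eq_one_iff A φ w).2 hw).symm
    · exact ((char_diagProj A φ w).resolve_right fun h => hw ((char_eq_one_iff A φ w).1 h)).symm
  change ((gelfandStarTransform (diagonal A)).symm
    ((cylinderIndicator A w).comp (charMap A)) : CKAlgebra A) = _
  rw [h, StarAlgEquiv.symm_apply_apply]
  rfl

end

variable {A : Matrix (Fin d) (Fin d) ℕ}

/-! ### The one-parameter automorphism group -/

/-- The unitary `U t = exp (i t (β - a))` of `C(Λ_A)`. -/
def phase (a : selfAdjoint C(Subshift A, ℂ)) (β t : ℝ) : C(Subshift A, ℂ) where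
  toFun x := Complex.exp (Complex.I * t * (β - a.1 x))
  continuous_toFun := by fun_prop

theorem star_phase_mul (a : selfAdjoint C(Subshift A, ℂ)) (β t : ℝ) :
    star (phase a β t) * phase a β t = 1 := by
  ext x
  have hx : star (a.1 x) = a.1 x := congrArg (fun f : C(Subshift A, ℂ) => f x) a.2
  change star (Complex.exp _) * Complex.exp _ = 1
  rw [Complex.star_def, ← Complex.exp_conj, ← Complex.exp_add]
  simp only [map_mul, Complex.conj_I, Complex.conj_ofReal, map_sub]
  rw [← Complex.star_def, hx, ← Complex.exp_zero]
  congr 1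
  ring

theorem phase_add (a : selfAdjoint C(Subshift A, ℂ)) (β t u : ℝ) :
    phase a β (t + u) = phase a β t * phase a β u := by
  ext x
  change Complex.exp _ = Complex.exp _ * Complex.exp _
  rw [← Complex.exp_add]
  congr 1
  push_cast
  ring

theorem phase_zero (a : selfAdjoint C(Subshift A, ℂ)) (β : ℝ) : phase a β 0 = 1 := by
  ext x
  change Complex.exp _ = 1
  simp

/-- The unitary `U t`, as an element of `O_A`. -/
def phaseElt (a : selfAdjoint C(Subshift A, ℂ)) (β t : ℝ) : CKAlgebra A :=
  diagEmbedding A (phase a β t)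

theorem star_phaseElt_mul (a : selfAdjoint C(Subshift A, ℂ)) (β t : ℝ) :
    star (phaseElt a β t) * phaseElt a β t = 1 := by
  rw [phaseElt, ← map_star, ← map_mul, star_phase_mul, map_one]

theorem conj_phaseElt (a : selfAdjoint C(Subshift A, ℂ)) (β t : ℝ) {x : CKAlgebra A}
    (hx : x ∈ diagonal A) : phaseElt a β t * x * star (phaseElt a β t) = x := by
  have h1 : phaseElt a β t * star (phaseElt a β t) = 1 := by
    rw [phaseElt, ← map_star, ← map_mul, mul_comm, star_phase_mul, map_one]
  have h2 : phaseElt a β t * x = x * phaseElt a β t := congrArg Subtype.val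
    (diagonal_mul_comm A ⟨_, diagEmbedding_mem A (phase a β t)⟩ ⟨x, hx⟩)
  rw [h2, mul_assoc, h1, mul_one]

theorem isCKFamily_phase (a : selfAdjoint C(Subshift A, ℂ)) (β t : ℝ) :
    IsCKFamily A fun i => phaseElt a β t * s A i := by
  have hr : ∀ i, phaseElt a β t * s A i * star (phaseElt a β t * s A i) =
      s A i * star (s A i) := fun i => by
    have := conj_phaseElt a β t (wordProj_mem_diagonal A [i])
    rw [wordProj_singleton] at this
    rw [star_mul]
    simpa only [mul_assoc] using this
  have hsrc : ∀ i, star (phaseElt a β t * s A i) * (phaseElt a β t * s A i) =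
      star (s A i) * s A i := fun i => by
    rw [star_mul, mul_assoc, ← mul_assoc (star (phaseElt a β t)), star_phaseElt_mul, one_mul]
  refine ⟨fun i => ?_, ?_, fun i => ?_⟩
  · rw [mul_assoc, hsrc, mul_assoc, ← mul_assoc (s A i), (isCKFamily_s A).partial_isometry]
  · simp only [hr]; exact (isCKFamily_s A).sum_range
  · simp only [hr, hsrc]; exact (isCKFamily_s A).source i

/-- The unital star-endomorphism of `O_A` with `s i ↦ U t * s i`. -/
def flowHom (a : selfAdjoint C(Subshift A, ℂ)) (β t : ℝ) : CKAlgebra A →⋆ₐ[ℂ] CKAlgebra A :=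
  lift (isCKFamily_phase a β t)

theorem flowHom_s (a : selfAdjoint C(Subshift A, ℂ)) (β t : ℝ) (i : Fin d) :
    flowHom a β t (s A i) = phaseElt a β t * s A i := lift_s _ i

theorem flowHom_wordProj (a : selfAdjoint C(Subshift A, ℂ)) (β t : ℝ) (w : List (Fin d)) :
    flowHom a β t (wordProj A w) = wordProj A w := by
  induction w with
  | nil => rw [wordProj_nil, map_one]
  | cons i w ih =>
    rw [wordProj_cons, map_mul, map_mul, map_star, flowHom_s, ih, star_mul]
    have := conj_phaseElt a β t (wordProj_mem_diagonal A (i :: w))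
    rw [wordProj_cons] at this
    simpa only [mul_assoc] using this

open scoped CStarAlgebra in
theorem flowHom_of_mem_diagonal (a : selfAdjoint C(Subshift A, ℂ)) (β t : ℝ) {x : CKAlgebra A}
    (hx : x ∈ diagonal A) : flowHom a β t x = x := by
  have hc : Continuous (flowHom a β t) := map_continuous (flowHom a β t)
  have hle : diagonal A ≤ StarAlgHom.equalizer (flowHom a β t) (StarAlgHom.id ℂ (CKAlgebra A)) := by
    refine StarSubalgebra.topologicalClosure_minimal ?_ (isClosed_eq hc continuous_id)
    rw [StarAlgebra.adjoin_le_iff]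
    rintro _ ⟨w, rfl⟩
    exact flowHom_wordProj a β t w
  exact hle hx

theorem flowHom_comp (a : selfAdjoint C(Subshift A, ℂ)) (β t u : ℝ) :
    (flowHom a β t).comp (flowHom a β u) = flowHom a β (t + u) := by
  refine hom_ext fun i => ?_
  rw [StarAlgHom.comp_apply, flowHom_s, map_mul, flowHom_s, flowHom_s,
    flowHom_of_mem_diagonal a β t (x := phaseElt a β u) (diagEmbedding_mem A _), ← mul_assoc]
  congr 1
  rw [phaseElt, phaseElt, phaseElt, ← map_mul, add_comm, phase_add]

theorem flowHom_zero (a : selfAdjoint C(Subshift A, ℂ)) (β : ℝ) :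
    flowHom a β 0 = StarAlgHom.id ℂ (CKAlgebra A) := by
  refine hom_ext fun i => ?_
  rw [flowHom_s, phaseElt, phase_zero, map_one, one_mul]
  rfl

/-- The one-parameter automorphism group `α^{β,a}` of `O_A`, determined by `s i ↦ U t * s i`; see
`flow_s`, `flow_zero` and `flow_add`. -/
def flow (a : selfAdjoint C(Subshift A, ℂ)) (β t : ℝ) : CKAlgebra A ≃⋆ₐ[ℂ] CKAlgebra A :=
  StarAlgEquiv.ofStarAlgHom (flowHom a β t) (flowHom a β (-t))
    (by rw [flowHom_comp, neg_add_cancel, flowHom_zero])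
    (by rw [flowHom_comp, add_neg_cancel, flowHom_zero])

theorem flow_s (a : selfAdjoint C(Subshift A, ℂ)) (β t : ℝ) (i : Fin d) :
    flow a β t (s A i) = diagEmbedding A (phase a β t) * s A i := flowHom_s a β t i

theorem flow_zero (a : selfAdjoint C(Subshift A, ℂ)) (β : ℝ) (x : CKAlgebra A) :
    flow a β 0 x = x := congrArg (fun f : CKAlgebra A →⋆ₐ[ℂ] CKAlgebra A => f x) (flowHom_zero a β)

theorem flow_add (a : selfAdjoint C(Subshift A, ℂ)) (β t u : ℝ) (x : CKAlgebra A) :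
    flow a β (t + u) x = flow a β t (flow a β u x) :=
  congrArg (fun f : CKAlgebra A →⋆ₐ[ℂ] CKAlgebra A => f x) (flowHom_comp a β t u).symm

end CKAlgebra

/-! ### States and the KMS condition -/

open scoped ComplexOrder in
/-- `ω` is a state: a positive linear functional with `ω 1 = 1`. -/
structure IsState {B : Type*} [CStarAlgebra B] (ω : B →L[ℂ] ℂ) : Prop where
  map_one : ω 1 = 1
  nonneg : ∀ x, 0 ≤ ω (star x * x)

/-- `ω` is a KMS state for the dynamics `α` at inverse temperature `b > 0`: for all `x`, `y` there
is a bounded continuous function on the strip `0 ≤ Im z ≤ b`, analytic in its interior, whose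
boundary values are `ω (x α_t(y))` at `t` and `ω (α_t(y) x)` at `t + i b`. -/
structure IsKMSState {B : Type*} [CStarAlgebra B] (α : ℝ → B ≃⋆ₐ[ℂ] B) (b : ℝ)
    (ω : B →L[ℂ] ℂ) : Prop where
  isState : IsState ω
  kms : ∀ x y : B, ∃ F : ℂ → ℂ,
    ContinuousOn F {z | 0 ≤ z.im ∧ z.im ≤ b} ∧
    DifferentiableOn ℂ F {z | 0 < z.im ∧ z.im < b} ∧
    (∃ C, ∀ z, 0 ≤ z.im → z.im ≤ b → ‖F z‖ ≤ C) ∧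
    ∀ t : ℝ, F t = ω (x * α t y) ∧ F (t + b * Complex.I) = ω (α t y * x)

/-! ### The Ruelle transfer operator -/

section
variable {A : Matrix (Fin d) (Fin d) ℕ}

/-- The point `i x₀ x₁ …`, for `A i x₀ = 1`. -/
def prepend (i : Fin d) (x : Subshift A) (h : A i (x.1 0) = 1) : Subshift A :=
  ⟨fun n => Nat.casesOn n i x.1, fun n => by cases n with
    | zero => exact h
    | succ n => exact x.2 n⟩

theorem continuous_branch (i : Fin d) (g : C(Subshift A, ℂ)) : Continuous fun x : Subshift A =>
    if h : A i (x.1 0) = 1 then g (prepend i x h) else 0 := by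
  have h0 : Continuous fun x : Subshift A => x.1 0 :=
    (continuous_apply 0).comp continuous_subtype_val
  have hcl : IsClopen {x : Subshift A | A i (x.1 0) = 1} :=
    (isClopen_discrete {j | A i j = 1}).preimage h0
  rw [continuous_iff_continuousAt]
  intro x
  by_cases hx : A i (x.1 0) = 1
  · have hc : Continuous fun y : {x : Subshift A | A i (x.1 0) = 1} =>
        g (prepend i y.1 y.2) := by
      refine g.continuous.comp (Continuous.subtype_mk (continuous_pi fun n => ?_) _)
      cases n with
      | zero => exact continuous_const
      | succ n =>
        exact (continuous_apply n).comp (continuous_subtype_val.comp continuous_subtype_val)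
    let y : {x : Subshift A | A i (x.1 0) = 1} := ⟨x, hx⟩
    have hemb : Topology.IsOpenEmbedding
        (Subtype.val : {x : Subshift A | A i (x.1 0) = 1} → Subshift A) :=
      hcl.isOpen.isOpenEmbedding_subtypeVal
    refine (hemb.continuousAt_iff (x := y)).1 ?_
    convert hc.continuousAt using 2 with y
    exact dif_pos y.2
  · refine (continuousAt_const (y := (0 : ℂ))).congr ?_
    filter_upwards [hcl.compl.isOpen.mem_nhds hx] with y hy
    have hy' : ¬ A i (y.1 0) = 1 := hy
    rw [dif_neg hy']

/-- The Ruelle transfer operator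
`(L_a f) x = ∑_{i : A i x₀ = 1} exp (a (i x)) f (i x)` on `C(Λ_A)`. -/
def ruelle (a : C(Subshift A, ℂ)) : C(Subshift A, ℂ) →ₗ[ℂ] C(Subshift A, ℂ) where
  toFun f :=
    { toFun := fun x => ∑ i, if h : A i (x.1 0) = 1 then
        Complex.exp (a (prepend i x h)) * f (prepend i x h) else 0
      continuous_toFun := continuous_finsetSum _ fun i _ =>
        continuous_branch i (⟨fun x => Complex.exp (a x), by fun_prop⟩ * f) }
  map_add' f g := by
    ext x
    simp only [ContinuousMap.coe_mk, ContinuousMap.add_apply, ← Finset.sum_add_distrib]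
    refine Finset.sum_congr rfl fun i _ => ?_
    split_ifs <;> ring
  map_smul' c f := by
    ext x
    simp only [ContinuousMap.coe_mk, ContinuousMap.smul_apply, smul_eq_mul, RingHom.id_apply,
      Finset.mul_sum]
    refine Finset.sum_congr rfl fun i _ => ?_
    split_ifs <;> ring

/-- `max a - min a`, for a real-valued function `a` (extrema are attained, by compactness). -/
def var₀ (a : C(Subshift A, ℂ)) : ℝ := (⨆ x, (a x).re) - ⨅ x, (a x).re

/-- The `(α^{β,a}, 1)`-KMS states of `O_A`. -/
def kmsStates (a : selfAdjoint C(Subshift A, ℂ)) (β : ℝ) : Set (CKAlgebra A →L[ℂ] ℂ) :=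
  {ω | IsKMSState (CKAlgebra.flow a β) 1 ω}

/-- The Borel probability measures `μ` on `Λ_A` with `L_a* μ = e^β μ`, where `L_a*` is the Banach
space adjoint of `L_a` and `μ` is regarded as a functional on `C(Λ_A)`. -/
def eigenmeasures (a : selfAdjoint C(Subshift A, ℂ)) (β : ℝ) :
    Set (MeasureTheory.ProbabilityMeasure (Subshift A)) :=
  {μ | ∀ f : C(Subshift A, ℂ),
    ∫ x, ruelle a.1 f x ∂(μ : MeasureTheory.Measure (Subshift A)) =
      (Real.exp β : ℂ) * ∫ x, f x ∂(μ : MeasureTheory.Measure (Subshift A))}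

end

/-- `A` is aperiodic: some positive power of `A` has only positive entries. -/
def IsAperiodic (A : Matrix (Fin d) (Fin d) ℕ) : Prop :=
  ∃ N, 0 < N ∧ ∀ i j, 0 < (A ^ N) i j

/-- The spectral radius `r(A)` of `A`, as a complex matrix. -/
def specRadius (A : Matrix (Fin d) (Fin d) ℕ) : ℝ :=
  (spectralRadius ℂ (A.map (Nat.cast : ℕ → ℂ))).toReal

end CuntzKrieger

end

/-! Put U(z) = exp(iz(β - a)), an entire function with values in C(Λ_A); then U(i) = e^{-β} e^a is
the weight of the Ruelle operator divided by the desired eigenvalue. The KMS condition is equivalent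
to two algebraic relations (`IsConformal`): ω(x U(i) s_i) = ω(s_i x), and ω(x f) = ω(f x) for f in
the diagonal. They follow from KMS because a strip function is determined by its values on the real
line. Conversely (`IsConformal.isKMSState`), the elements with an entire orbit that satisfy the
algebraic KMS relation are stable under sums and products, and the three lines theorem carries the
KMS condition to norm limits.

Into: since f s_i = s_i (f ∘ i) (`diagEmbedding_mul_s`), the i-th branch of L_a f is s_i* (e^a f)
s_i. Conformality moves the right-hand s_i to the left and produces the factor e^β; summing over i
with ∑ s_i s_i* = 1 gives the eigenvalue equation (`apply_ruelle`). The Riesz representation theorem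
turns the restricted state into a measure.

Onto: O_A acts on ℓ²(Λ_A × ℤ) by s_i δ(x,k) = δ(ix, k+1). The diagonal matrix coefficients at level
0 give a conditional expectation E onto C(Λ_A), and ω = ∫ E(·) dμ is a state restricting to μ. The
identity E(b U(i) s_i) = e^{-β} L_a E(s_i b) (`expectation_mul_s`) makes ω conformal as soon as μ is
an eigenmeasure.

One-to-one: suppose ‖U(i)‖ < 1. Conformality rotates the letters of a nonempty word w cyclically
inside ω(s_w f), and each rotation multiplies f by U(i), so ω(s_w f) = 0. Stripping common letters
from s_v s_w* then shows that ω is determined by its restriction (`eq_of_diagEmbedding`). The norm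
bound means max a < β. It comes from counting words: ∫ L_a^n 1 dμ = e^{nβ}, while L_a^n 1 is at
least e^{n min a} times a column sum of A^n. By aperiodicity these sums grow at least like r(A)^n,
so β ≥ min a + log r(A) > max a. -/

noncomputable section

namespace CuntzKrieger

variable {d : ℕ} {A : Matrix (Fin d) (Fin d) ℕ}

/-! ### Density of the span of the elements s_v s_w*. -/

namespace CKAlgebra

/-- A closed property of elements of `O_A` that holds for scalars, the generators and their
adjoints and is stable under sums and products holds everywhere. -/
theorem induction_on {p : CKAlgebra A → Prop} (hp : IsClosed {x | p x})
    (hc : ∀ c : ℂ, p (algebraMap ℂ _ c)) (hs : ∀ i, p (s A i)) (hs' : ∀ i, p (star (s A i)))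
    (hadd : ∀ x y, p x → p y → p (x + y)) (hmul : ∀ x y, p x → p y → p (x * y))
    (x : CKAlgebra A) : p x := by
  refine (denseRange_of A).induction_on (p := p) x hp fun y => ?_
  induction y using FreeStarAlgebra.induction with
  | hc c => exact ((of A).commutes c).symm ▸ hc c
  | hl q =>
    rcases q with ⟨i, _ | _⟩
    · exact hs i
    · have e : of A (FreeStarAlgebra.letter (i, true)) = star (s A i) :=
        (congrArg (of A) (FreeStarAlgebra.star_letter (i, false)).symm).trans
          (star_of A _).symm
      exact e.symm ▸ hs' i
  | hadd x y hx hy =>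
    have e : of A (x + y) = of A x + of A y := map_add (of A) x y
    exact e.symm ▸ hadd _ _ hx hy
  | hmul x y hx hy =>
    have e : of A (x * y) = of A x * of A y := map_mul (of A) x y
    exact e.symm ▸ hmul _ _ hx hy

theorem word_nil : word A [] = 1 := by simp [word]

theorem word_cons (i : Fin d) (w : List (Fin d)) : word A (i :: w) = s A i * word A w := by
  simp [word]

theorem word_append (v w : List (Fin d)) : word A (v ++ w) = word A v * word A w := by
  simp [word]

theorem star_s_mul_word_cons (i j : Fin d) (w : List (Fin d)) :
    star (s A i) * word A (j :: w) =
      if i = j then star (s A i) * s A i * word A w else 0 := by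
  rw [word_cons, ← mul_assoc]
  split_ifs with h
  · rw [h]
  · rw [star_s_mul_s_of_ne A h, zero_mul]

/-- The source projection of s_i is a combination of range projections, and orthogonality of ranges
leaves only the j-th term. -/
theorem source_mul_s (i j : Fin d) : star (s A i) * s A i * s A j = A i j • s A j := by
  rw [source_eq, Finset.sum_mul, Finset.sum_eq_single j]
  · rw [smul_mul_assoc, wordProj_singleton, (isCKFamily_s A).partial_isometry]
  · intro k _ hk
    rw [smul_mul_assoc, wordProj_singleton, mul_assoc, star_s_mul_s_of_ne A hk, mul_zero,
      smul_zero]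
  · simp

variable (A) in
/-- The span of the elements `s v (s w)*`. -/
def wordSpan : Submodule ℂ (CKAlgebra A) :=
  Submodule.span ℂ (Set.range fun p : List (Fin d) × List (Fin d) => word A p.1 * star (word A p.2))

theorem word_mul_star_word_mem (v w : List (Fin d)) :
    word A v * star (word A w) ∈ wordSpan A := Submodule.subset_span ⟨(v, w), rfl⟩

theorem one_mem_wordSpan : (1 : CKAlgebra A) ∈ wordSpan A := by
  simpa [word_nil] using word_mul_star_word_mem (A := A) [] []

theorem mul_mem_wordSpan_of_forall {b : CKAlgebra A}
    (hb : ∀ v w, b * (word A v * star (word A w)) ∈ wordSpan A) {x : CKAlgebra A}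
    (hx : x ∈ wordSpan A) : b * x ∈ wordSpan A := by
  induction hx using Submodule.span_induction with
  | mem x hx => obtain ⟨⟨v, w⟩, rfl⟩ := hx; exact hb v w
  | zero => rw [mul_zero]; exact zero_mem _
  | add x y _ _ hx hy => rw [mul_add]; exact add_mem hx hy
  | smul c x _ hx => rw [mul_smul_comm]; exact Submodule.smul_mem _ c hx

theorem s_mul_mem_wordSpan (i : Fin d) {x : CKAlgebra A} (hx : x ∈ wordSpan A) :
    s A i * x ∈ wordSpan A :=
  mul_mem_wordSpan_of_forall (fun v w => by
    rw [← mul_assoc, ← word_cons]; exact word_mul_star_word_mem _ _) hx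

/-- If v is empty, the source relation replaces s_i* s_i by a sum of s_j s_j*, which lengthens both
words by j; otherwise s_i* s_i acts on the first letter of v as a scalar. -/
theorem source_mul_word_mem (i : Fin d) (v w : List (Fin d)) :
    star (s A i) * s A i * (word A v * star (word A w)) ∈ wordSpan A := by
  rcases v with _ | ⟨j, v⟩
  · rw [source_eq, Finset.sum_mul]
    refine sum_mem fun j _ => ?_
    rw [smul_mul_assoc, wordProj_singleton, word_nil, one_mul, mul_assoc, ← star_mul]
    refine nsmul_mem ?_ _
    simpa [word_append, word_cons, word_nil] using word_mul_star_word_mem (A := A) [j] (w ++ [j])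
  · rw [word_cons, mul_assoc (s A j), ← mul_assoc, source_mul_s, smul_mul_assoc, ← mul_assoc,
      ← word_cons]
    exact nsmul_mem (word_mul_star_word_mem _ _) _

theorem star_s_mul_mem_wordSpan (i : Fin d) {x : CKAlgebra A} (hx : x ∈ wordSpan A) :
    star (s A i) * x ∈ wordSpan A := by
  refine mul_mem_wordSpan_of_forall (fun v w => ?_) hx
  rcases v with _ | ⟨j, v⟩
  · rw [word_nil, one_mul, ← star_mul]
    simpa [word_append, word_cons, word_nil] using word_mul_star_word_mem (A := A) [] (w ++ [i])
  · rw [← mul_assoc, star_s_mul_word_cons]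
    split_ifs
    · rw [mul_assoc]; exact source_mul_word_mem i v w
    · rw [zero_mul]; exact zero_mem _

theorem mem_closure_wordSpan (x : CKAlgebra A) : x ∈ (wordSpan A).topologicalClosure := by
  -- The x that multiply the closed span into itself from the left form a closed subalgebra, so
  -- generators and their adjoints suffice; y = 1 then recovers x.
  suffices h : ∀ y ∈ (wordSpan A).topologicalClosure,
      x * y ∈ (wordSpan A).topologicalClosure by
    simpa using h 1 (Submodule.le_topologicalClosure _ one_mem_wordSpan)
  have hcl : IsClosed ((wordSpan A).topologicalClosure : Set (CKAlgebra A)) :=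
    Submodule.isClosed_topologicalClosure _
  have ext : ∀ b : CKAlgebra A, (∀ y ∈ wordSpan A, b * y ∈ wordSpan A) →
      ∀ y ∈ (wordSpan A).topologicalClosure, b * y ∈ (wordSpan A).topologicalClosure :=
    fun b hb y hy => map_mem_closure (continuous_const_mul b) hy hb
  induction x using induction_on with
  | hp =>
    simp only [Set.ofPred_forall]
    exact isClosed_iInter fun y => isClosed_iInter fun _ =>
      hcl.preimage (continuous_mul_const y)
  | hc c =>
    intro y hy
    rw [← Algebra.smul_def]
    exact Submodule.smul_mem _ c hy
  | hs i => exact ext _ fun y hy => s_mul_mem_wordSpan i hy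
  | hs' i => exact ext _ fun y hy => star_s_mul_mem_wordSpan i hy
  | hadd a b ha hb => intro y hy; rw [add_mul]; exact add_mem (ha y hy) (hb y hy)
  | hmul a b ha hb => intro y hy; rw [mul_assoc]; exact ha _ (hb y hy)

/-- A closed linear property of elements of `O_A` only has to be checked on the elements
`s v (s w)*`. -/
theorem induction_on_word {p : CKAlgebra A → Prop} (hp : IsClosed {x | p x}) (h0 : p 0)
    (hadd : ∀ x y, p x → p y → p (x + y)) (hsmul : ∀ (c : ℂ) x, p x → p (c • x))
    (hw : ∀ v w, p (word A v * star (word A w))) (x : CKAlgebra A) : p x := by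
  have hle : ∀ y ∈ wordSpan A, p y := fun y hy => by
    induction hy using Submodule.span_induction with
    | mem x hx => obtain ⟨⟨v, w⟩, rfl⟩ := hx; exact hw v w
    | zero => exact h0
    | add x y _ _ hx hy => exact hadd x y hx hy
    | smul c x _ hx => exact hsmul c x hx
  exact closure_minimal (t := {x | p x}) hle hp (mem_closure_wordSpan x)

end CKAlgebra

/-! ### Continuous functions on the subshift -/

instance : CompactSpace (Subshift A) := by
  refine isCompact_iff_compactSpace.1 (IsClosed.isCompact ?_)
  change IsClosed {x : ℕ → Fin d | ∀ n, A (x n) (x (n + 1)) = 1}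
  rw [Set.ofPred_forall]
  refine isClosed_iInter fun n => ?_
  have h : Continuous fun x : ℕ → Fin d => (x n, x (n + 1)) := by fun_prop
  exact (isClosed_discrete {q : Fin d × Fin d | A q.1 q.2 = 1}).preimage h

open CKAlgebra in
theorem ext_of_initWord {x y : Subshift A}
    (h : ∀ n, initWord x.1 n = initWord y.1 n) : x = y := by
  refine Subtype.ext (funext fun n => ?_)
  have h1 := h (n + 1)
  rw [initWord_succ, initWord_succ, h n] at h1
  simpa using h1

open CKAlgebra in
/-- A closed property of continuous functions on `Λ_A` that holds for constants and for
indicators of cylinders and is stable under sums and products holds everywhere. -/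
theorem continuousMap_induction {p : C(Subshift A, ℂ) → Prop} (hp : IsClosed {f | p f})
    (hc : ∀ c : ℂ, p (algebraMap ℂ _ c)) (hw : ∀ w, p (cylinderIndicator A w))
    (hadd : ∀ f g, p f → p g → p (f + g)) (hmul : ∀ f g, p f → p g → p (f * g))
    (f : C(Subshift A, ℂ)) : p f := by
  set S : Set C(Subshift A, ℂ) := Set.range (cylinderIndicator A) with hS
  -- The indicators are self-adjoint, so the star-algebra they generate is the plain algebra they
  -- generate and the induction needs no case for adjoints.
  have hstar : star S = S := by
    have h1 : ∀ w, star (cylinderIndicator A w) = cylinderIndicator A w := fun w => by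
      ext x
      change star (if _ then (1 : ℂ) else 0) = if _ then (1 : ℂ) else 0
      split_ifs <;> simp
    ext g
    constructor
    · rintro ⟨w, hw⟩
      exact ⟨w, by rw [← h1, hw, star_star]⟩
    · rintro ⟨w, rfl⟩
      exact ⟨w, (h1 w).symm⟩
  -- Stone–Weierstrass: two points with the same initial words coincide, so cylinders separate
  -- points.
  have hsep : (StarAlgebra.adjoin ℂ S).SeparatesPoints := by
    intro x y hxy
    by_contra! h
    refine hxy (ext_of_initWord fun n => ?_)
    have h1 := h (cylinderIndicator A (initWord x.1 n))
      ⟨_, StarAlgebra.subset_adjoin ℂ S ⟨_, rfl⟩, rfl⟩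
    change (if _ then (1 : ℂ) else 0) = if _ then (1 : ℂ) else 0 at h1
    rw [length_initWord, if_pos rfl] at h1
    by_contra hne
    rw [if_neg (Ne.symm hne)] at h1
    exact one_ne_zero h1
  have htop := ContinuousMap.starSubalgebra_topologicalClosure_eq_top_of_separatesPoints _ hsep
  have hle : ∀ g ∈ StarAlgebra.adjoin ℂ S, p g := fun g hg => by
    have hg' : g ∈ Algebra.adjoin ℂ S := by
      have : g ∈ (StarAlgebra.adjoin ℂ S).toSubalgebra := hg
      rwa [StarAlgebra.adjoin_toSubalgebra, hstar, Set.union_self] at this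
    clear hg
    induction hg' using Algebra.adjoin_induction with
    | mem g hg => obtain ⟨w, rfl⟩ := hg; exact hw w
    | algebraMap c => exact hc c
    | add f g _ _ hf hg => exact hadd f g hf hg
    | mul f g _ _ hf hg => exact hmul f g hf hg
  have hf : f ∈ (StarAlgebra.adjoin ℂ S).topologicalClosure := by rw [htop]; trivial
  exact closure_minimal (t := {f | p f}) hle hp hf

/-- The function `x ↦ f (i x)`, extended by zero to the points that `i` cannot precede. -/
def branch (i : Fin d) (f : C(Subshift A, ℂ)) : C(Subshift A, ℂ) :=
  ⟨fun x => if h : A i (x.1 0) = 1 then f (prepend i x h) else 0, continuous_branch i f⟩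

theorem branch_apply (i : Fin d) (f : C(Subshift A, ℂ)) (x : Subshift A) :
    branch i f x = if h : A i (x.1 0) = 1 then f (prepend i x h) else 0 := rfl

theorem branch_mul (i : Fin d) (f g : C(Subshift A, ℂ)) :
    branch i (f * g) = branch i f * branch i g := by
  ext x
  simp only [branch_apply, ContinuousMap.mul_apply]
  split_ifs <;> simp

theorem branch_add (i : Fin d) (f g : C(Subshift A, ℂ)) :
    branch i (f + g) = branch i f + branch i g := by
  ext x
  simp only [branch_apply, ContinuousMap.add_apply]
  split_ifs <;> simp

theorem norm_branch_le (i : Fin d) (f : C(Subshift A, ℂ)) : ‖branch i f‖ ≤ ‖f‖ := by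
  refine (ContinuousMap.norm_le _ (norm_nonneg f)).2 fun x => ?_
  rw [branch_apply]
  split_ifs
  · exact f.norm_coe_le_norm _
  · simp

theorem continuous_branch' (i : Fin d) : Continuous (branch i : C(Subshift A, ℂ) → _) :=
  AddMonoidHomClass.continuous_of_bound
    (AddMonoidHom.mk' (branch i) (branch_add i)) 1 fun f => by
      rw [one_mul]; exact norm_branch_le i f

/-- The exponential of a continuous function. -/
def expMap (f : C(Subshift A, ℂ)) : C(Subshift A, ℂ) := ⟨fun x => Complex.exp (f x), by fun_prop⟩

/-- Inside O_A each branch is a compression s_i* (·) s_i, so this form is what links the transfer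
operator to the algebra. -/
theorem ruelle_eq (a f : C(Subshift A, ℂ)) :
    ruelle a f = ∑ i, branch i (expMap a * f) := by
  ext x
  rw [ContinuousMap.sum_apply]
  rfl

theorem initWord_prepend (i : Fin d) (x : Subshift A) (h : A i (x.1 0) = 1) (n : ℕ) :
    initWord (prepend i x h).1 (n + 1) = i :: initWord x.1 n := by
  simp only [initWord, List.range_succ_eq_map, List.map_cons, List.map_map]
  rfl

/-! ### Commutation of the diagonal with the generators. -/

namespace CKAlgebra

theorem cylinderIndicator_apply (w : List (Fin d)) (x : Subshift A) :
    cylinderIndicator A w x = if initWord x.1 w.length = w then 1 else 0 := rfl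

theorem cylinderIndicator_nil : cylinderIndicator A [] = 1 := by
  ext x
  simp [cylinderIndicator_apply, initWord]

/-- The factor `branch i 1` is the indicator of the points that i may precede; without it the
right-hand side would ignore admissibility. -/
theorem branch_cylinderIndicator_cons (i j : Fin d) (w : List (Fin d)) :
    branch i (cylinderIndicator A (j :: w)) =
      if i = j then branch i 1 * cylinderIndicator A w else 0 := by
  ext x
  rw [branch_apply]
  by_cases hij : i = j
  · subst hij
    simp only [cylinderIndicator_apply, List.length_cons, initWord_prepend, if_true,
      ContinuousMap.mul_apply, branch_apply, List.cons.injEq, true_and]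
    split_ifs <;> simp
  · simp [cylinderIndicator_apply, initWord_prepend, hij]

theorem branch_one (hA01 : ∀ i j, A i j = 0 ∨ A i j = 1) (i : Fin d) :
    branch i (1 : C(Subshift A, ℂ)) = ∑ j, A i j • cylinderIndicator A [j] := by
  ext x
  have h1 : ∀ j, cylinderIndicator A [j] x = if x.1 0 = j then 1 else 0 := fun j => by
    simp [cylinderIndicator_apply, initWord]
  simp only [branch_apply, ContinuousMap.one_apply, ContinuousMap.sum_apply,
    ContinuousMap.smul_apply, h1]
  rw [Finset.sum_eq_single (x.1 0)]
  · rcases hA01 i (x.1 0) with h | h <;> simp [h]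
  · intro j _ hj
    rw [if_neg (Ne.symm hj), smul_zero]
  · simp

theorem diagEmbedding_branch_one (hA01 : ∀ i j, A i j = 0 ∨ A i j = 1) (i : Fin d) :
    diagEmbedding A (branch i 1) = star (s A i) * s A i := by
  rw [branch_one hA01, map_sum, source_eq]
  refine Finset.sum_congr rfl fun j _ => ?_
  rw [map_nsmul, diagEmbedding_cylinderIndicator]

open scoped CStarAlgebra in
theorem continuous_diagEmbedding : Continuous (diagEmbedding A) := map_continuous _

/-- The covariance relation of O_A. Both sides are continuous, additive and compatible with products
in f, so constants and cylinders suffice; a cylinder starting with i loses its first letter, and the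
source projection absorbs the admissibility factor. -/
theorem diagEmbedding_mul_s (hA01 : ∀ i j, A i j = 0 ∨ A i j = 1) (i : Fin d)
    (f : C(Subshift A, ℂ)) :
    diagEmbedding A f * s A i = s A i * diagEmbedding A (branch i f) := by
  have hone : s A i * diagEmbedding A (branch i 1) = s A i := by
    rw [diagEmbedding_branch_one hA01, ← mul_assoc, (isCKFamily_s A).partial_isometry]
  induction f using continuousMap_induction with
  | hp =>
    exact isClosed_eq (continuous_diagEmbedding.mul_const _)
      ((continuous_diagEmbedding.comp (continuous_branch' i)).const_mul _)
  | hc c =>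
    have e : branch i (algebraMap ℂ C(Subshift A, ℂ) c) = c • branch i 1 := by
      ext x
      rw [ContinuousMap.smul_apply, branch_apply, branch_apply]
      split_ifs <;> simp
    rw [e, map_smul, mul_smul_comm, hone, AlgHomClass.commutes, ← Algebra.smul_def]
  | hw w =>
    rcases w with _ | ⟨j, w⟩
    · rw [cylinderIndicator_nil, hone, map_one, one_mul]
    · rw [branch_cylinderIndicator_cons, diagEmbedding_cylinderIndicator, wordProj_cons]
      split_ifs with h
      · subst h
        rw [map_mul, diagEmbedding_cylinderIndicator, ← mul_assoc, hone, mul_assoc, mul_assoc,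
          ← (commute_source A i w).eq, ← mul_assoc, ← mul_assoc,
          (isCKFamily_s A).partial_isometry]
      · rw [mul_assoc, star_s_mul_s_of_ne A (Ne.symm h), map_zero, mul_zero, mul_zero]
  | hadd f g hf hg => rw [branch_add, map_add, map_add, add_mul, mul_add, hf, hg]
  | hmul f g hf hg => rw [branch_mul, map_mul, map_mul, mul_assoc, hg, ← mul_assoc, hf, mul_assoc]

theorem source_mul_diagEmbedding_branch (hA01 : ∀ i j, A i j = 0 ∨ A i j = 1) (i : Fin d)
    (f : C(Subshift A, ℂ)) :
    star (s A i) * s A i * diagEmbedding A (branch i f) = diagEmbedding A (branch i f) := by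
  rw [← diagEmbedding_branch_one hA01, ← map_mul, ← branch_mul, one_mul]

theorem star_s_mul_diagEmbedding_mul_s (hA01 : ∀ i j, A i j = 0 ∨ A i j = 1) (i j : Fin d)
    (f : C(Subshift A, ℂ)) :
    star (s A j) * diagEmbedding A f * s A i =
      if j = i then diagEmbedding A (branch i f) else 0 := by
  rw [mul_assoc, diagEmbedding_mul_s hA01, ← mul_assoc]
  split_ifs with h
  · rw [h, source_mul_diagEmbedding_branch hA01]
  · rw [star_s_mul_s_of_ne A h, zero_mul]

end CKAlgebra

open Complex Filter Topology

/-! ### Holomorphic functions on a strip -/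

/-- `F` is bounded and continuous on the strip `0 ≤ Im z ≤ 1` and holomorphic in its interior. -/
structure IsStripFunction (F : ℂ → ℂ) : Prop where
  continuousOn : ContinuousOn F {z | 0 ≤ z.im ∧ z.im ≤ 1}
  differentiableOn : DifferentiableOn ℂ F {z | 0 < z.im ∧ z.im < 1}
  bounded : ∃ C, ∀ z, 0 ≤ z.im → z.im ≤ 1 → ‖F z‖ ≤ C

namespace IsStripFunction

/-- Hadamard's three lines theorem on the vertical strip, transported by the rotation w ↦ iw, under
which Im(iw) = Re w. -/
theorem norm_le_interp {F : ℂ → ℂ} (hF : IsStripFunction F) {a b : ℝ}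
    (ha : ∀ t : ℝ, ‖F t‖ ≤ a) (hb : ∀ t : ℝ, ‖F (t + I)‖ ≤ b) {z : ℂ} (h0 : 0 ≤ z.im)
    (h1 : z.im ≤ 1) : ‖F z‖ ≤ a ^ (1 - z.im) * b ^ z.im := by
  have him : ∀ w : ℂ, (I * w).im = w.re := fun w => by simp
  have hcont : Continuous fun w : ℂ => I * w := by fun_prop
  have hd : DiffContOnCl ℂ (fun w => F (I * w)) (HadamardThreeLines.verticalStrip 0 1) := by
    refine ⟨?_, ?_⟩
    · refine hF.differentiableOn.comp (by fun_prop) fun w hw => ?_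
      change 0 < (I * w).im ∧ (I * w).im < 1
      rw [him]
      exact hw
    · refine hF.continuousOn.comp hcont.continuousOn fun w hw => ?_
      change 0 ≤ (I * w).im ∧ (I * w).im ≤ 1
      rw [him]
      rw [HadamardThreeLines.verticalStrip, closure_preimage_re, closure_Ioo zero_ne_one] at hw
      exact hw
  have hB : BddAbove
      ((norm ∘ fun w => F (I * w)) '' HadamardThreeLines.verticalClosedStrip 0 1) := by
    obtain ⟨C, hC⟩ := hF.bounded
    refine ⟨C, ?_⟩
    rintro _ ⟨w, hw, rfl⟩
    exact hC _ (by rw [him]; exact hw.1) (by rw [him]; exact hw.2)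
  have hz : -I * z ∈ HadamardThreeLines.verticalClosedStrip 0 1 := by
    change (-I * z).re ∈ Set.Icc (0 : ℝ) 1
    simpa using! ⟨h0, h1⟩
  have := HadamardThreeLines.norm_le_interp_of_mem_verticalClosedStrip₀₁' (fun w => F (I * w))
    hz hd hB (a := a) (b := b) (fun w hw => by
      have e : I * w = ((-w.im : ℝ) : ℂ) := by
        have : w.re = 0 := hw
        apply Complex.ext <;> simp [this]
      change ‖F (I * w)‖ ≤ a
      rw [e]; exact ha _) (fun w hw => by
      have e : I * w = ((-w.im : ℝ) : ℂ) + I := by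
        have : w.re = 1 := hw
        apply Complex.ext <;> simp [this]
      change ‖F (I * w)‖ ≤ b
      rw [e]; exact hb _)
  have e1 : I * (-I * z) = z := by rw [← mul_assoc]; simp
  have e2 : (-I * z).re = z.im := by simp
  simpa only [e1, e2] using this

theorem norm_le {F : ℂ → ℂ} (hF : IsStripFunction F) {C : ℝ}
    (ha : ∀ t : ℝ, ‖F t‖ ≤ C) (hb : ∀ t : ℝ, ‖F (t + I)‖ ≤ C) {z : ℂ} (h0 : 0 ≤ z.im)
    (h1 : z.im ≤ 1) : ‖F z‖ ≤ C := by
  have := hF.norm_le_interp ha hb h0 h1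
  rwa [← Real.rpow_add' ((norm_nonneg _).trans (ha 0)) (by simp), sub_add_cancel,
    Real.rpow_one] at this

theorem sub {F G : ℂ → ℂ} (hF : IsStripFunction F) (hG : IsStripFunction G) :
    IsStripFunction fun z => F z - G z where
  continuousOn := hF.continuousOn.sub hG.continuousOn
  differentiableOn := hF.differentiableOn.sub hG.differentiableOn
  bounded := by
    obtain ⟨C, hC⟩ := hF.bounded
    obtain ⟨D, hD⟩ := hG.bounded
    exact ⟨C + D, fun z h0 h1 => (norm_sub_le _ _).trans (add_le_add (hC z h0 h1) (hD z h0 h1))⟩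

/-- With bound 0 on the real line the interpolated bound vanishes for Im z < 1. At Im z = 1 it says
nothing, since 0^0 = 1, so the value at I is reached by continuity along the segment from 0. -/
theorem apply_I_eq_zero {F : ℂ → ℂ} (hF : IsStripFunction F) (h : ∀ t : ℝ, F t = 0) :
    F I = 0 := by
  obtain ⟨C, hC⟩ := hF.bounded
  have hz : ∀ u : ℝ, u ∈ Set.Ico (0 : ℝ) 1 → F (u * I) = 0 := fun u hu => by
    have := hF.norm_le_interp (a := 0) (b := C) (fun t => by simp [h])
      (fun t => hC _ (by simp) (by simp)) (z := u * I) (by simpa using hu.1)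
      (by simpa using hu.2.le)
    rw [Real.zero_rpow (by simpa using (sub_pos.2 hu.2).ne'), zero_mul] at this
    simpa using this
  have hmem : I ∈ {z : ℂ | 0 ≤ z.im ∧ z.im ≤ 1} := by simp
  have ht : Tendsto (fun u : ℝ => (u : ℂ) * I) (𝓝[Set.Ico 0 1] 1)
      (𝓝[{z : ℂ | 0 ≤ z.im ∧ z.im ≤ 1}] I) := by
    refine tendsto_nhdsWithin_iff.2 ⟨?_, ?_⟩
    · have hc : Continuous fun u : ℝ => (u : ℂ) * I := by fun_prop
      simpa using (hc.tendsto 1).mono_left nhdsWithin_le_nhds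
    · filter_upwards [self_mem_nhdsWithin] with u hu
      simpa using ⟨hu.1, hu.2.le⟩
  have h1 : Tendsto (fun u : ℝ => F (u * I)) (𝓝[Set.Ico 0 1] 1) (𝓝 (F I)) :=
    (hF.continuousOn I hmem).tendsto.comp ht
  have hne : (𝓝[Set.Ico (0 : ℝ) 1] 1).NeBot := by
    rw [← mem_closure_iff_nhdsWithin_neBot, closure_Ico zero_ne_one]
    simp
  refine tendsto_nhds_unique h1 (Tendsto.congr' ?_ tendsto_const_nhds)
  filter_upwards [self_mem_nhdsWithin] with u hu
  exact (hz u hu).symm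

/-- A strip function is determined at `I` by its values on the real line. -/
theorem apply_I_eq {F G : ℂ → ℂ} (hF : IsStripFunction F) (hG : IsStripFunction G)
    (h : ∀ t : ℝ, F t = G t) : F I = G I :=
  sub_eq_zero.1 ((hF.sub hG).apply_I_eq_zero fun t => sub_eq_zero.2 (h t))

/-- A sequence of strip functions that converges uniformly on the boundary converges to a strip
function. -/
theorem exists_limit {F : ℕ → ℂ → ℂ} (hF : ∀ n, IsStripFunction (F n)) {u : ℕ → ℝ}
    (hu : Tendsto u atTop (𝓝 0)) (ha : ∀ m n, ∀ t : ℝ, ‖F m t - F n t‖ ≤ u m + u n)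
    (hb : ∀ m n, ∀ t : ℝ, ‖F m (t + I) - F n (t + I)‖ ≤ u m + u n) :
    ∃ G, IsStripFunction G ∧
      ∀ z : ℂ, 0 ≤ z.im → z.im ≤ 1 → Tendsto (fun n => F n z) atTop (𝓝 (G z)) := by
  -- The maximum principle for differences upgrades the boundary estimate to the whole strip.
  have key : ∀ m n, ∀ z : ℂ, 0 ≤ z.im → z.im ≤ 1 → ‖F m z - F n z‖ ≤ u m + u n :=
    fun m n z h0 h1 => ((hF m).sub (hF n)).norm_le (ha m n) (hb m n) h0 h1
  have hC : UniformCauchySeqOn F atTop {z : ℂ | 0 ≤ z.im ∧ z.im ≤ 1} := by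
    rw [Metric.uniformCauchySeqOn_iff]
    intro ε hε
    obtain ⟨N, hN⟩ := eventually_atTop.1 (hu.eventually (gt_mem_nhds (half_pos hε)))
    refine ⟨N, fun m hm n hn z hz => ?_⟩
    rw [dist_eq_norm]
    have := key m n z hz.1 hz.2
    linarith [hN m hm, hN n hn]
  -- Phrased for every z so that the limit is a total function; its value off the strip is the
  -- arbitrary 0.
  have hlim : ∀ z : ℂ, ∃ l, 0 ≤ z.im → z.im ≤ 1 → Tendsto (fun n => F n z) atTop (𝓝 l) := by
    intro z
    by_cases hz : 0 ≤ z.im ∧ z.im ≤ 1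
    · obtain ⟨l, hl⟩ := cauchySeq_tendsto_of_complete (hC.cauchySeq hz)
      exact ⟨l, fun _ _ => hl⟩
    · exact ⟨0, fun h0 h1 => absurd ⟨h0, h1⟩ hz⟩
  choose G hG using hlim
  have hunif := hC.tendstoUniformlyOn_of_tendsto fun z hz => hG z hz.1 hz.2
  refine ⟨G, ⟨?_, ?_, ?_⟩, hG⟩
  · exact hunif.continuousOn (Frequently.of_forall fun n => (hF n).continuousOn)
  · refine (hunif.mono fun z hz => ⟨hz.1.le, hz.2.le⟩).tendstoLocallyUniformlyOn.differentiableOn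
      (Eventually.of_forall fun n => (hF n).differentiableOn) ?_
    exact (isOpen_lt continuous_const continuous_im).inter
      (isOpen_lt continuous_im continuous_const)
  · obtain ⟨C, hC⟩ := (hF 0).bounded
    refine ⟨C + u 0, fun z h0 h1 => ?_⟩
    have h2 : Tendsto (fun n => C + u 0 + u n) atTop (𝓝 (C + u 0 + 0)) := hu.const_add _
    rw [add_zero] at h2
    refine le_of_tendsto_of_tendsto' (hG z h0 h1).norm h2 fun n => ?_
    have e : F n z = F 0 z - (F 0 z - F n z) := by ring
    rw [e]
    linarith [norm_sub_le (F 0 z) (F 0 z - F n z), hC z h0 h1, key 0 n z h0 h1]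

end IsStripFunction

/-! ### Analytic elements and the KMS condition -/

section
variable {B : Type*} [CStarAlgebra B]

/-- Polarisation: ω is real on squares of 1 + b and 1 + ib, which determines the imaginary and the
real part of ω(b*) respectively. -/
theorem IsState.star_apply {ω : B →L[ℂ] ℂ} (hω : IsState ω) (b : B) : ω (star b) = star (ω b) := by
  have him : ∀ x, (ω (star x * x)).im = 0 := fun x => (Complex.le_def.1 (hω.nonneg x)).2.symm
  have h1 := him (1 + b)
  have h2 := him (1 + I • b)
  have e1 : star (1 + b) * (1 + b) = 1 + b + star b + star b * b := by
    rw [star_add, star_one]; noncomm_ring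
  have e2 : star (1 + I • b) * (1 + I • b) = 1 + I • b - I • star b + star b * b := by
    rw [star_add, star_one, star_smul]
    have hI : I • I • (star b * b) = -(star b * b) := by rw [smul_smul, I_mul_I, neg_one_smul]
    simp only [star_def, conj_I, neg_smul, add_mul, mul_add, one_mul, mul_one, smul_mul_assoc,
      mul_smul_comm, neg_mul, smul_add, smul_neg, hI]
    abel
  rw [e1] at h1
  rw [e2] at h2
  simp only [map_add, map_sub, map_smul, hω.map_one, add_im, sub_im, him b, one_im, smul_eq_mul,
    mul_im, I_re, I_im] at h1 h2
  apply Complex.ext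
  · simp; linarith
  · simp; linarith

/-- `G` is an entire extension, bounded on the strip `0 ≤ Im z ≤ 1`, of the orbit map of `y`. -/
structure IsAnalyticExtension (α : ℝ → B ≃⋆ₐ[ℂ] B) (y : B) (G : ℂ → B) : Prop where
  differentiable : Differentiable ℂ G
  bounded : ∃ C, ∀ z : ℂ, 0 ≤ z.im → z.im ≤ 1 → ‖G z‖ ≤ C
  apply_ofReal : ∀ t : ℝ, G t = α t y

variable {α : ℝ → B ≃⋆ₐ[ℂ] B} {ω : B →L[ℂ] ℂ}

theorem IsAnalyticExtension.isStripFunction {y : B} {G : ℂ → B} (h : IsAnalyticExtension α y G)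
    (x : B) : IsStripFunction fun z => ω (x * G z) := by
  have hd : Differentiable ℂ fun z => ω (x * G z) :=
    ω.differentiable.comp ((differentiable_const x).mul h.differentiable)
  refine ⟨hd.continuous.continuousOn, hd.differentiableOn, ?_⟩
  obtain ⟨C, hC⟩ := h.bounded
  refine ⟨‖ω‖ * (‖x‖ * C), fun z h0 h1 => ?_⟩
  refine (ω.le_opNorm _).trans ?_
  gcongr
  exact (norm_mul_le _ _).trans (by gcongr; exact hC z h0 h1)

theorem IsKMSState.isStripFunction (h : IsKMSState α 1 ω) (x y : B) : ∃ F, IsStripFunction F ∧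
    ∀ t : ℝ, F t = ω (x * α t y) ∧ F (t + I) = ω (α t y * x) := by
  obtain ⟨F, h1, h2, h3, h4⟩ := h.kms x y
  refine ⟨F, ⟨h1, h2, h3⟩, fun t => ⟨(h4 t).1, ?_⟩⟩
  simpa using (h4 t).2

/-- The KMS condition for an analytic element. -/
theorem IsKMSState.apply_mul_I (h : IsKMSState α 1 ω) (h0 : ∀ x, α 0 x = x) {y : B} {G : ℂ → B}
    (hG : IsAnalyticExtension α y G) (x : B) : ω (x * G I) = ω (y * x) := by
  obtain ⟨F, hF, hF'⟩ := h.isStripFunction x y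
  have := hF.apply_I_eq (hG.isStripFunction (ω := ω) x) fun t => by
    rw [(hF' t).1, hG.apply_ofReal]
  rw [← this]
  have h2 := (hF' 0).2
  rwa [ofReal_zero, zero_add, h0] at h2

/-- `y` is analytic and satisfies the algebraic form of the KMS condition. -/
def IsKMSElement (α : ℝ → B ≃⋆ₐ[ℂ] B) (ω : B →L[ℂ] ℂ) (y : B) : Prop :=
  ∃ G, IsAnalyticExtension α y G ∧ ∀ (x : B) (t : ℝ), ω (x * G (t + I)) = ω (α t y * x)

theorem isKMSElement_algebraMap (c : ℂ) : IsKMSElement α ω (algebraMap ℂ B c) := by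
  have e : ∀ t, α t (algebraMap ℂ B c) = algebraMap ℂ B c := fun t => by
    rw [Algebra.algebraMap_eq_smul_one, map_smul, map_one]
  refine ⟨fun _ => algebraMap ℂ B c, ⟨differentiable_const _, ⟨_, fun _ _ _ => le_rfl⟩,
    fun t => (e t).symm⟩, fun x t => ?_⟩
  rw [e, Algebra.commutes]

theorem IsKMSElement.add {x y : B} (hx : IsKMSElement α ω x) (hy : IsKMSElement α ω y) :
    IsKMSElement α ω (x + y) := by
  obtain ⟨G, hG, hG'⟩ := hx
  obtain ⟨H, hH, hH'⟩ := hy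
  refine ⟨fun z => G z + H z, ⟨hG.differentiable.add hH.differentiable, ?_, fun t => ?_⟩,
    fun b t => ?_⟩
  · obtain ⟨C, hC⟩ := hG.bounded
    obtain ⟨D, hD⟩ := hH.bounded
    exact ⟨C + D, fun z h0 h1 => (norm_add_le _ _).trans (add_le_add (hC z h0 h1) (hD z h0 h1))⟩
  · rw [hG.apply_ofReal, hH.apply_ofReal, map_add]
  · rw [mul_add, map_add, hG', hH', map_add, add_mul, map_add]

/-- Move the extension of y to the front first, then that of x; this works because the relation is
required against every element of the algebra. -/
theorem IsKMSElement.mul {x y : B} (hx : IsKMSElement α ω x) (hy : IsKMSElement α ω y) :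
    IsKMSElement α ω (x * y) := by
  obtain ⟨G, hG, hG'⟩ := hx
  obtain ⟨H, hH, hH'⟩ := hy
  refine ⟨fun z => G z * H z, ⟨hG.differentiable.mul hH.differentiable, ?_, fun t => ?_⟩,
    fun b t => ?_⟩
  · obtain ⟨C, hC⟩ := hG.bounded
    obtain ⟨D, hD⟩ := hH.bounded
    exact ⟨C * D, fun z h0 h1 => (norm_mul_le _ _).trans (mul_le_mul (hC z h0 h1) (hD z h0 h1)
      (norm_nonneg _) ((norm_nonneg _).trans (hC z h0 h1)))⟩
  · rw [hG.apply_ofReal, hH.apply_ofReal, map_mul]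
  · rw [← mul_assoc b, hH', ← mul_assoc (α t y), hG', map_mul (α t), mul_assoc]

/-- A state is KMS if the elements that satisfy the KMS condition algebraically are dense. -/
theorem isKMSState_of_dense (hω : IsState ω) (h : Dense {y | IsKMSElement α ω y}) :
    IsKMSState α 1 ω := by
  refine ⟨hω, fun x y => ?_⟩
  obtain ⟨u, hu, hlim⟩ := mem_closure_iff_seq_limit.1 (h y)
  choose G hG hG' using hu
  set M : ℝ := ‖ω‖ * ‖x‖ with hM
  -- Automorphisms are isometric, so norm approximation of y gives approximation of the boundary
  -- values uniformly in t.
  have hnorm : ∀ t (b : B), ‖α t b‖ = ‖b‖ := fun t b => StarAlgEquiv.norm_map (α t) b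
  have hb1 : ∀ t b, ‖ω (x * α t b)‖ ≤ M * ‖b‖ := fun t b => by
    refine (ω.le_opNorm _).trans ?_
    rw [hM, mul_assoc]
    gcongr
    exact (norm_mul_le _ _).trans (by rw [hnorm])
  have hb2 : ∀ t b, ‖ω (α t b * x)‖ ≤ M * ‖b‖ := fun t b => by
    refine (ω.le_opNorm _).trans ?_
    rw [hM, mul_assoc]
    gcongr
    exact (norm_mul_le _ _).trans (by rw [hnorm, mul_comm])
  have hM0 : 0 ≤ M := by positivity
  have htri : ∀ m n, M * ‖u m - u n‖ ≤ M * ‖u m - y‖ + M * ‖u n - y‖ := fun m n => by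
    rw [← mul_add]
    gcongr
    have e : u m - u n = (u m - y) - (u n - y) := by abel
    rw [e]
    exact norm_sub_le _ _
  have hu0 : Tendsto (fun n => M * ‖u n - y‖) atTop (𝓝 0) := by
    simpa using (tendsto_iff_norm_sub_tendsto_zero.1 hlim).const_mul M
  obtain ⟨F, hF, hF'⟩ := IsStripFunction.exists_limit
    (F := fun n z => ω (x * G n z)) (fun n => (hG n).isStripFunction x) hu0
    (fun m n t => by
      rw [(hG m).apply_ofReal, (hG n).apply_ofReal, ← map_sub, ← mul_sub, ← map_sub]
      exact (hb1 t _).trans (htri m n))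
    (fun m n t => by
      rw [hG' m, hG' n, ← map_sub, ← sub_mul, ← map_sub]
      exact (hb2 t _).trans (htri m n))
  have hcα : ∀ t, Tendsto (fun n => α t (u n)) atTop (𝓝 (α t y)) := fun t =>
    ((StarAlgEquiv.isometry (α t)).continuous.tendsto y).comp hlim
  refine ⟨F, hF.continuousOn, hF.differentiableOn, hF.bounded, fun t => ⟨?_, ?_⟩⟩
  · refine tendsto_nhds_unique (hF' t (by simp) (by simp)) ?_
    simp only [(hG _).apply_ofReal]
    exact (ω.continuous.tendsto _).comp ((hcα t).const_mul x)
  · rw [ofReal_one, one_mul]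
    refine tendsto_nhds_unique (hF' (t + I) (by simp) (by simp)) ?_
    simp only [hG']
    exact (ω.continuous.tendsto _).comp ((hcα t).mul_const x)

end

/-! ### KMS states of `O_A` -/

theorem star_apply_of_selfAdjoint (a : selfAdjoint C(Subshift A, ℂ)) (x : Subshift A) :
    star (a.1 x) = a.1 x :=
  congrArg (fun f : C(Subshift A, ℂ) => f x) a.2

theorem ofReal_re_of_selfAdjoint (a : selfAdjoint C(Subshift A, ℂ)) (x : Subshift A) :
    ((a.1 x).re : ℂ) = a.1 x :=
  conj_eq_iff_re.1 (star_apply_of_selfAdjoint a x)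

namespace CKAlgebra

/-- The entire extension `exp (i z (β - a))` of `phase`. -/
def phaseExt (a : selfAdjoint C(Subshift A, ℂ)) (β : ℝ) (z : ℂ) : C(Subshift A, ℂ) where
  toFun x := exp (I * z * (β - a.1 x))
  continuous_toFun := by fun_prop

variable (a : selfAdjoint C(Subshift A, ℂ)) (β : ℝ)

theorem phaseExt_apply (z : ℂ) (x : Subshift A) :
    phaseExt a β z x = exp (I * z * (β - a.1 x)) := rfl

theorem phaseExt_ofReal (t : ℝ) : phaseExt a β t = phase a β t := rfl

theorem phaseExt_add (z w : ℂ) : phaseExt a β (z + w) = phaseExt a β z * phaseExt a β w := by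
  ext x
  rw [ContinuousMap.mul_apply, phaseExt_apply, phaseExt_apply, phaseExt_apply, ← Complex.exp_add]
  congr 1
  ring

/-- In particular U(i) is self-adjoint and U(t)* = U(-t) for real t. -/
theorem star_phaseExt (z : ℂ) : star (phaseExt a β z) = phaseExt a β (-star z) := by
  ext x
  change star (exp _) = exp _
  have hx := star_apply_of_selfAdjoint a x
  rw [star_def] at hx ⊢
  rw [← exp_conj]
  simp only [map_mul, conj_I, conj_ofReal, map_sub, hx]
  congr 1
  ring

/-- The point where dynamics meets thermodynamics: continuing the flow to time i produces the Ruelle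
weight, normalised by the eigenvalue. -/
theorem phaseExt_I : phaseExt a β I = Real.exp (-β) • expMap a.1 := by
  ext x
  change exp _ = (Real.exp (-β)) • exp (a.1 x)
  rw [real_smul, ofReal_exp, ← Complex.exp_add, I_mul_I]
  congr 1
  push_cast
  ring

/-- U(z) is the Banach algebra exponential of z · i(β - a); this is checked pointwise, since
evaluation is a continuous algebra map. -/
theorem differentiable_phaseExt : Differentiable ℂ (phaseExt a β) := by
  let h : C(Subshift A, ℂ) := ⟨fun x => I * (β - a.1 x), by fun_prop⟩
  have e : phaseExt a β = fun z : ℂ => NormedSpace.exp (z • h) := by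
    funext z
    ext x
    have h1 := NormedSpace.map_exp (ContinuousMap.evalAlgHom ℂ ℂ x)
      (continuous_eval_const x) (z • h)
    have h2 : ContinuousMap.evalAlgHom ℂ ℂ x (z • h) = z * (I * (β - a.1 x)) := rfl
    rw [h2, ← Complex.exp_eq_exp_ℂ] at h1
    rw [phaseExt_apply]
    refine Eq.trans ?_ h1.symm
    congr 1
    ring
  rw [e]
  exact differentiable_exp_smul_const ℂ h

theorem norm_phaseExt_le (z : ℂ) :
    ‖phaseExt a β z‖ ≤ Real.exp (|z.im| * (|β| + ‖a.1‖)) := by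
  refine (ContinuousMap.norm_le _ (Real.exp_nonneg _)).2 fun x => ?_
  rw [phaseExt_apply, norm_exp, ← ofReal_re_of_selfAdjoint a x]
  refine Real.exp_le_exp.2 ?_
  have e : (I * z * ((β : ℂ) - ((a.1 x).re : ℂ))).re = -(z.im * (β - (a.1 x).re)) := by
    rw [← ofReal_sub, re_mul_ofReal]
    simp
  rw [e]
  refine (neg_le_abs _).trans ?_
  rw [abs_mul]
  gcongr
  refine (abs_sub _ _).trans ?_
  gcongr
  exact (abs_re_le_norm _).trans (a.1.norm_coe_le_norm x)

theorem bounded_phaseExt {z : ℂ} (h : |z.im| ≤ 1) :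
    ‖diagEmbedding A (phaseExt a β z)‖ ≤ Real.exp (|β| + ‖a.1‖) := by
  refine (NonUnitalStarAlgHom.norm_apply_le (diagEmbedding A) _).trans
    ((norm_phaseExt_le a β z).trans (Real.exp_le_exp.2 ?_))
  exact mul_le_of_le_one_left (by positivity) h

open scoped CStarAlgebra in
theorem differentiable_diagEmbedding {f : ℂ → C(Subshift A, ℂ)} (hf : Differentiable ℂ f) :
    Differentiable ℂ fun z => diagEmbedding A (f z) :=
  let L : C(Subshift A, ℂ) →L[ℂ] CKAlgebra A :=
    ⟨(diagEmbedding A).toAlgHom.toLinearMap, continuous_diagEmbedding⟩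
  L.differentiable.comp hf

/-- The KMS condition for `flow a β` on the generators and the diagonal. -/
structure IsConformal (ω : CKAlgebra A →L[ℂ] ℂ) : Prop where
  apply_mul_s : ∀ (i : Fin d) (x : CKAlgebra A),
    ω (x * diagEmbedding A (phaseExt a β I) * s A i) = ω (s A i * x)
  apply_comm : ∀ (f : C(Subshift A, ℂ)) (x : CKAlgebra A),
    ω (x * diagEmbedding A f) = ω (diagEmbedding A f * x)

theorem flow_diagEmbedding (t : ℝ) (f : C(Subshift A, ℂ)) :
    flow a β t (diagEmbedding A f) = diagEmbedding A f :=
  flowHom_of_mem_diagonal a β t (diagEmbedding_mem A f)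

theorem flow_star_s (t : ℝ) (i : Fin d) :
    flow a β t (star (s A i)) = star (s A i) * diagEmbedding A (phaseExt a β (-t)) := by
  rw [map_star, flow_s, star_mul, ← map_star, ← phaseExt_ofReal, star_phaseExt]
  simp

theorem isAnalyticExtension_s (i : Fin d) : IsAnalyticExtension (flow a β) (s A i)
    fun z => diagEmbedding A (phaseExt a β z) * s A i where
  differentiable :=
    (differentiable_diagEmbedding (differentiable_phaseExt a β)).mul (differentiable_const _)
  bounded := ⟨Real.exp (|β| + ‖a.1‖) * ‖s A i‖, fun z h0 h1 =>
    (norm_mul_le _ _).trans (by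
      gcongr; exact bounded_phaseExt a β (abs_le.2 ⟨by linarith, h1⟩))⟩
  apply_ofReal t := (flow_s a β t i).symm

/-- The adjoint of z ↦ U(z) s_i would be antiholomorphic; using U(-z), which agrees with U(z)* on
the real line, keeps the extension entire. -/
theorem isAnalyticExtension_star_s (i : Fin d) : IsAnalyticExtension (flow a β) (star (s A i))
    fun z => star (s A i) * diagEmbedding A (phaseExt a β (-z)) where
  differentiable := (differentiable_const _).mul
    (differentiable_diagEmbedding ((differentiable_phaseExt a β).comp differentiable_neg))
  bounded := ⟨‖star (s A i)‖ * Real.exp (|β| + ‖a.1‖), fun z h0 h1 =>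
    (norm_mul_le _ _).trans (by
      gcongr
      exact bounded_phaseExt a β (by rw [neg_im, abs_neg]; exact abs_le.2 ⟨by linarith, h1⟩))⟩
  apply_ofReal t := (flow_star_s a β t i).symm

variable {a β} {ω : CKAlgebra A →L[ℂ] ℂ}

/-- The analytic form of the KMS condition for s_i, and for diagonal elements, which the flow fixes,
so that their extension is constant. -/
theorem _root_.CuntzKrieger.IsKMSState.isConformal (h : IsKMSState (flow a β) 1 ω) :
    IsConformal a β ω where
  apply_mul_s i x := by
    rw [mul_assoc]
    exact h.apply_mul_I (flow_zero a β) (isAnalyticExtension_s a β i) x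
  apply_comm f x := h.apply_mul_I (flow_zero a β) (G := fun _ => diagEmbedding A f)
    ⟨differentiable_const _, ⟨_, fun _ _ _ => le_rfl⟩, fun t => (flow_diagEmbedding a β t f).symm⟩ x

namespace IsConformal

/-- The adjoint of the relation for s_i; it uses that states are hermitian and that U(i) is
self-adjoint. -/
theorem apply_mul_star_s (h : IsConformal a β ω) (hω : IsState ω) (i : Fin d) (x : CKAlgebra A) :
    ω (star (s A i) * diagEmbedding A (phaseExt a β I) * x) = ω (x * star (s A i)) := by
  have h1 := congrArg star (h.apply_mul_s i (star x))
  rw [← hω.star_apply, ← hω.star_apply] at h1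
  simpa [star_mul, ← map_star, star_phaseExt, mul_assoc] using h1

theorem isKMSState (h : IsConformal a β ω) (hω : IsState ω) : IsKMSState (flow a β) 1 ω := by
  refine isKMSState_of_dense hω fun y => ?_
  induction y using induction_on with
  | hp => exact isClosed_closure
  | hc c => exact subset_closure (isKMSElement_algebraMap c)
  | hs i =>
    -- Split U(t + i) = U(t) U(i): conformality consumes U(i) s_i, and the diagonal factor U(t) then
    -- commutes under ω to the front.
    refine subset_closure ⟨_, isAnalyticExtension_s a β i, fun x t => ?_⟩
    rw [phaseExt_add, phaseExt_ofReal, map_mul (diagEmbedding A), ← mul_assoc, ← mul_assoc,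
      h.apply_mul_s, ← mul_assoc, h.apply_comm, flow_s, mul_assoc]
  | hs' i =>
    refine subset_closure ⟨_, isAnalyticExtension_star_s a β i, fun x t => ?_⟩
    -- This splits off from the flowed adjoint the factor U(i) needed by the adjoint relation.
    have e : phaseExt a β (-t : ℝ) = phaseExt a β I * phaseExt a β (-(t + I)) := by
      rw [← phaseExt_add]
      congr 1
      push_cast
      ring
    rw [flow_star_s, ← ofReal_neg, e, map_mul (diagEmbedding A), ← mul_assoc (star _),
      mul_assoc _ _ x, h.apply_mul_star_s hω, ← mul_assoc, h.apply_comm, mul_assoc]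
  | hadd x y hx hy =>
    exact map_mem_closure₂ continuous_add hx hy fun x hx y hy => IsKMSElement.add hx hy
  | hmul x y hx hy =>
    exact map_mem_closure₂ continuous_mul hx hy fun x hx y hy => IsKMSElement.mul hx hy

/-- The restriction of a conformal functional to the diagonal is an eigenvector of the dual of the
Ruelle operator. -/
theorem apply_ruelle (h : IsConformal a β ω) (hA01 : ∀ i j, A i j = 0 ∨ A i j = 1)
    (f : C(Subshift A, ℂ)) :
    ω (diagEmbedding A (ruelle a.1 f)) = Real.exp β * ω (diagEmbedding A f) := by
  have e : expMap a.1 = (Real.exp β : ℂ) • phaseExt a β I := by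
    rw [phaseExt_I]
    ext x
    simp [← mul_assoc, ← Complex.exp_add]
  -- Write the branch as s_i* (e^a f) s_i and use e^a = e^β U(i): moving s_i round to the front
  -- absorbs U(i) and leaves e^β.
  have hi : ∀ i, ω (diagEmbedding A (branch i (expMap a.1 * f))) =
      Real.exp β * ω (s A i * star (s A i) * diagEmbedding A f) := fun i => by
    have h1 := star_s_mul_diagEmbedding_mul_s hA01 i i (expMap a.1 * f)
    rw [if_pos rfl] at h1
    rw [← h1, e, mul_comm, mul_smul_comm, map_smul, mul_smul_comm, smul_mul_assoc, map_smul,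
      smul_eq_mul, map_mul (diagEmbedding A), ← mul_assoc, h.apply_mul_s, mul_assoc]
  rw [ruelle_eq, map_sum, map_sum, Finset.sum_congr rfl fun i _ => hi i, ← Finset.mul_sum,
    ← map_sum, ← Finset.sum_mul, (isCKFamily_s A).sum_range, one_mul]

/-! ### Uniqueness -/

/-- Moves the leading letter to the back, at the cost of a factor U(i) in the diagonal part. -/
theorem apply_word_mul (h : IsConformal a β ω) (hA01 : ∀ i j, A i j = 0 ∨ A i j = 1)
    (i : Fin d) (x : CKAlgebra A) (f : C(Subshift A, ℂ)) :
    ω (s A i * x * diagEmbedding A f) =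
      ω (x * s A i * diagEmbedding A (branch i (f * phaseExt a β I))) := by
  rw [mul_assoc, ← h.apply_mul_s, mul_assoc x, ← map_mul, mul_assoc, diagEmbedding_mul_s hA01,
    mul_assoc]

theorem norm_word_le (w : List (Fin d)) : ‖word A w‖ ≤ 1 := by
  have h1 : ∀ i, ‖s A i‖ ≤ 1 := fun i =>
    (norm_of A _).trans_le ((isCKSeminorm_ckSeminorm A).gen_le i)
  induction w with
  | nil => rw [word_nil, ← map_one (of A), norm_of]; exact (isCKSeminorm_ckSeminorm A).one_le
  | cons i w ih =>
    rw [word_cons]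
    exact (norm_mul_le _ _).trans (mul_le_one₀ (h1 i) (norm_nonneg _) ih)

/-- A nonempty word can be rotated forever: its length stays the same, and each turn contributes a
factor ‖U(i)‖ to the bound on the diagonal part. -/
theorem norm_apply_word_le (h : IsConformal a β ω) (hA01 : ∀ i j, A i j = 0 ∨ A i j = 1)
    (n : ℕ) (i : Fin d) (w : List (Fin d)) (f : C(Subshift A, ℂ)) :
    ‖ω (word A (i :: w) * diagEmbedding A f)‖ ≤ ‖ω‖ * (‖f‖ * ‖phaseExt a β I‖ ^ n) := by
  induction n generalizing i w f with
  | zero =>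
    refine (ω.le_opNorm _).trans ?_
    gcongr
    rw [pow_zero, mul_one]
    refine (norm_mul_le _ _).trans
      ((mul_le_of_le_one_left (norm_nonneg _) (norm_word_le _)).trans ?_)
    exact NonUnitalStarAlgHom.norm_apply_le (diagEmbedding A) f
  | succ n ih =>
    rw [word_cons, h.apply_word_mul hA01]
    have e : word A w * s A i = word A (w ++ [i]) := by simp [word]
    obtain ⟨j, v, hv⟩ : ∃ j v, w ++ [i] = j :: v := List.exists_cons_of_ne_nil (by simp)
    rw [e, hv]
    refine (ih j v _).trans ?_
    rw [pow_succ', ← mul_assoc ‖f‖]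
    gcongr
    exact (norm_branch_le _ _).trans (norm_mul_le _ _)

theorem apply_word_eq_zero (h : IsConformal a β ω) (hA01 : ∀ i j, A i j = 0 ∨ A i j = 1)
    (hk : ‖phaseExt a β I‖ < 1) (i : Fin d) (w : List (Fin d)) (f : C(Subshift A, ℂ)) :
    ω (word A (i :: w) * diagEmbedding A f) = 0 := by
  rw [← norm_le_zero_iff]
  have ht : Tendsto (fun n : ℕ => ‖ω‖ * (‖f‖ * ‖phaseExt a β I‖ ^ n)) atTop
      (𝓝 (‖ω‖ * (‖f‖ * 0))) :=
    ((tendsto_pow_atTop_nhds_zero_of_lt_one (norm_nonneg _) hk).const_mul _).const_mul _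
  rw [mul_zero, mul_zero] at ht
  exact ge_of_tendsto' ht fun n => h.norm_apply_word_le hA01 n i w f

/-- If `a < β`, a conformal state is determined by its restriction to the diagonal. -/
theorem eq_of_diagEmbedding {ω' : CKAlgebra A →L[ℂ] ℂ} (h : IsConformal a β ω) (hω : IsState ω)
    (h' : IsConformal a β ω') (hω' : IsState ω') (hA01 : ∀ i j, A i j = 0 ∨ A i j = 1)
    (hk : ‖phaseExt a β I‖ < 1)
    (heq : ∀ f, ω (diagEmbedding A f) = ω' (diagEmbedding A f)) : ω = ω' := by
  -- The vanishing on words, transferred to adjoints of words by hermitian symmetry.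
  have hnil : ∀ {η : CKAlgebra A →L[ℂ] ℂ}, IsConformal a β η → IsState η →
      ∀ (j : Fin d) (w : List (Fin d)) (f : C(Subshift A, ℂ)),
      η (star (word A (j :: w)) * diagEmbedding A f) = 0 := fun {η} hη hη' j w f => by
    have h1 := hη.apply_word_eq_zero hA01 hk j w (star f)
    rw [hη.apply_comm] at h1
    have h2 := hη'.star_apply (diagEmbedding A (star f) * word A (j :: w))
    rw [h1, star_zero, star_mul, ← map_star, star_star] at h2
    exact h2
  -- The diagonal factor f must be arbitrary, because rotating the first letter of v onto that of w
  -- cancels the pair and changes f. Words of different lengths, or with mismatched letters, end in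
  -- zero; equal words end in the restriction to the diagonal.
  have key : ∀ v w (f : C(Subshift A, ℂ)), ω (word A v * star (word A w) * diagEmbedding A f) =
      ω' (word A v * star (word A w) * diagEmbedding A f) := by
    intro v
    induction v with
    | nil =>
      intro w f
      rcases w with _ | ⟨j, w⟩
      · simpa [word_nil] using heq f
      · rw [word_nil, one_mul, hnil h hω, hnil h' hω']
    | cons i v ih =>
      intro w f
      rcases w with _ | ⟨j, w⟩
      · rw [word_nil, star_one, mul_one, h.apply_word_eq_zero hA01 hk,
          h'.apply_word_eq_zero hA01 hk]
      · rw [word_cons i, mul_assoc (s A i), h.apply_word_mul hA01, h'.apply_word_mul hA01]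
        have e : word A v * star (word A (j :: w)) * s A i *
            diagEmbedding A (branch i (f * phaseExt a β I)) = if j = i then
            word A v * star (word A w) * diagEmbedding A (branch i (f * phaseExt a β I))
            else 0 := by
          rw [word_cons, star_mul]
          split_ifs with hij
          · subst hij
            simp only [mul_assoc]
            rw [← mul_assoc (star (s A j)), source_mul_diagEmbedding_branch hA01]
          · rw [mul_assoc, mul_assoc, mul_assoc, ← mul_assoc (star (s A j)),
              star_s_mul_s_of_ne A hij]
            simp
        rw [e]
        split_ifs
        · exact ih _ _
        · rw [map_zero, map_zero]
  ext x
  induction x using induction_on_word with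
  | hp => exact isClosed_eq ω.continuous ω'.continuous
  | h0 => rw [map_zero, map_zero]
  | hadd x y hx hy => rw [map_add, map_add, hx, hy]
  | hsmul c x hx => rw [map_smul, map_smul, hx]
  | hw v w => simpa using key v w 1

end IsConformal

end CKAlgebra

/-! ### Partial permutation operators on `ℓ²` -/

section
variable {X : Type*}

/-- The Hilbert space `ℓ²(X)`. -/
abbrev EllTwo (X : Type*) : Type _ := lp (fun _ : X => ℂ) 2

open Classical in
/-- The standard basis vector at `x`. -/
def basisVec (x : X) : EllTwo X := lp.single 2 x 1

open Classical in
theorem basisVec_apply (x y : X) : basisVec x y = if y = x then 1 else 0 := by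
  unfold basisVec
  rw [lp.single_apply, Pi.single_apply]

theorem norm_basisVec (x : X) : ‖basisVec x‖ = 1 := by
  classical
  rw [basisVec, lp.norm_single (by norm_num), norm_one]

theorem inner_basisVec (x : X) (f : EllTwo X) : inner ℂ (basisVec x) f = f x := by
  classical
  rw [basisVec, lp.inner_single_left]
  simp

/-- Injectivity of e makes the images of distinct points disjoint, so no |f y|² is counted twice. -/
theorem sum_pullback_le (e : X ≃. X) (f : EllTwo X) (t : Finset X) :
    ∑ x ∈ t, ‖(e x).elim 0 fun y => f y‖ ^ (2 : ENNReal).toReal ≤ ‖f‖ ^ (2 : ENNReal).toReal := by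
  classical
  have hdisj : (t : Set X).PairwiseDisjoint fun x => (e x).toFinset := by
    intro x _ y _ hxy
    refine Finset.disjoint_left.2 fun z hx hy => hxy ?_
    rw [Option.mem_toFinset] at hx hy
    exact e.inj hx hy
  have h1 : ∀ x, ‖(e x).elim 0 fun y => f y‖ ^ (2 : ENNReal).toReal =
      ∑ y ∈ (e x).toFinset, ‖f y‖ ^ (2 : ENNReal).toReal := fun x => by
    rcases e x with _ | y <;> simp
  rw [Finset.sum_congr rfl fun x _ => h1 x, ← Finset.sum_biUnion hdisj]
  exact lp.sum_rpow_le_norm_rpow (by norm_num) f _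

/-- The operator `f ↦ f ∘ e` on `ℓ²(X)`, where `f ∘ e` is extended by zero. -/
def pullback (e : X ≃. X) : EllTwo X →L[ℂ] EllTwo X :=
  LinearMap.mkContinuous
    { toFun := fun f => ⟨fun x => (e x).elim 0 fun y => f y, memℓp_gen' (sum_pullback_le e f)⟩
      map_add' := fun f g => by
        ext x
        change ((e x).elim 0 fun y => f y + g y) =
          ((e x).elim 0 fun y => f y) + (e x).elim 0 fun y => g y
        rcases e x with _ | y <;> simp
      map_smul' := fun c f => by
        ext x
        change ((e x).elim 0 fun y => c * f y) = c * (e x).elim 0 fun y => f y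
        rcases e x with _ | y <;> simp }
    1 fun f => by
      rw [one_mul]
      exact lp.norm_le_of_forall_sum_le (by norm_num) (norm_nonneg f) (sum_pullback_le e f)

theorem pullback_apply (e : X ≃. X) (f : EllTwo X) (x : X) :
    pullback e f x = (e x).elim 0 fun y => f y := rfl

/-- Coordinates are inner products with basis vectors, and composing δ_y with e gives δ_x if e x = y
for some x, and 0 otherwise. -/
theorem star_pullback (e : X ≃. X) : star (pullback e) = pullback e.symm := by
  ext f y
  rw [← inner_basisVec, ContinuousLinearMap.star_eq_adjoint,
    ContinuousLinearMap.adjoint_inner_right, pullback_apply]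
  rcases h : e.symm y with _ | x
  · have h0 : pullback e (basisVec y) = 0 := by
      ext x
      rw [pullback_apply]
      rcases h1 : e x with _ | z
      · rfl
      · change basisVec y z = 0
        rw [basisVec_apply, if_neg]
        rintro rfl
        have := (e.mem_iff_mem (a := x) (b := z)).2 h1
        rw [h] at this
        simp at this
    rw [h0, inner_zero_left]
    rfl
  · have h0 : pullback e (basisVec y) = basisVec x := by
      ext z
      rw [pullback_apply, basisVec_apply]
      have hz : y ∈ e z ↔ x = z := by
        rw [← e.mem_iff_mem, h, Option.mem_def, Option.some_inj]
      rcases h1 : e z with _ | w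
      · rw [h1] at hz
        rw [if_neg]
        · rfl
        · rintro rfl
          simp at hz
      · change basisVec y w = _
        rw [h1, Option.mem_def, Option.some_inj] at hz
        rw [basisVec_apply]
        congr 1
        exact propext (by rw [hz, eq_comm])
    rw [h0, inner_basisVec]
    rfl

end

/-! ### The orbit representation -/

/-- The shift `x₀ x₁ x₂ … ↦ x₁ x₂ …`. -/
def shift (x : Subshift A) : Subshift A := ⟨fun n => x.1 (n + 1), fun n => x.2 (n + 1)⟩

theorem shift_prepend (i : Fin d) (x : Subshift A) (h : A i (x.1 0) = 1) :
    shift (prepend i x h) = x := rfl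

theorem prepend_shift (x : Subshift A) : prepend (x.1 0) (shift x) (x.2 0) = x := by
  refine Subtype.ext (funext fun n => ?_)
  cases n <;> rfl

theorem initWord_zero (x : ℕ → Fin d) : initWord x 0 = [] := rfl

theorem initWord_succ' (x : Subshift A) (n : ℕ) :
    initWord x.1 (n + 1) = x.1 0 :: initWord (shift x).1 n := by
  simp only [initWord, List.range_succ_eq_map, List.map_cons, List.map_map]
  rfl

/-- The partial bijection `(y, k) ↦ (shift y, k - 1)` of the cylinder `y₀ = i`. -/
def orbitEquiv (A : Matrix (Fin d) (Fin d) ℕ) (i : Fin d) :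
    (Subshift A × ℤ) ≃. (Subshift A × ℤ) where
  toFun p := if p.1.1 0 = i then some (shift p.1, p.2 - 1) else none
  invFun q := if h : A i (q.1.1 0) = 1 then some (prepend i q.1 h, q.2 + 1) else none
  inv p q := by
    constructor
    · intro h
      split_ifs at h with h1
      rw [Option.some_inj] at h
      subst h
      rw [if_pos (show (prepend i q.1 h1).1 0 = i from rfl), shift_prepend, add_sub_cancel_right]
    · intro h
      split_ifs at h with h1
      rw [Option.some_inj] at h
      subst h
      subst h1
      rw [dif_pos (show A (p.1.1 0) ((shift p.1).1 0) = 1 from p.1.2 0)]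
      refine congrArg some (Prod.ext (prepend_shift _) (sub_add_cancel _ _))

theorem orbitEquiv_apply (i : Fin d) (p : Subshift A × ℤ) :
    orbitEquiv A i p = if p.1.1 0 = i then some (shift p.1, p.2 - 1) else none := rfl

theorem orbitEquiv_symm_apply (i : Fin d) (q : Subshift A × ℤ) :
    (orbitEquiv A i).symm q =
      if h : A i (q.1.1 0) = 1 then some (prepend i q.1 h, q.2 + 1) else none := rfl

theorem pullback_range_apply (i : Fin d) (f : EllTwo (Subshift A × ℤ)) (p : Subshift A × ℤ) :
    (pullback (orbitEquiv A i) * star (pullback (orbitEquiv A i))) f p =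
      if p.1.1 0 = i then f p else 0 := by
  rw [star_pullback]
  change pullback (orbitEquiv A i) (pullback (orbitEquiv A i).symm f) p = _
  rw [pullback_apply]
  rcases h1 : orbitEquiv A i p with _ | q
  · rw [orbitEquiv_apply] at h1
    split_ifs at h1 with h2
    rw [if_neg h2]
    rfl
  · change pullback (orbitEquiv A i).symm f q = _
    have h2 : (orbitEquiv A i).symm q = some p := (PEquiv.mem_iff_mem _).2 h1
    rw [pullback_apply, h2, if_pos]
    · rfl
    · rw [orbitEquiv_apply] at h1
      split_ifs at h1 with h3
      exact h3

theorem pullback_source_apply (i : Fin d) (f : EllTwo (Subshift A × ℤ)) (p : Subshift A × ℤ) :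
    (star (pullback (orbitEquiv A i)) * pullback (orbitEquiv A i)) f p =
      if A i (p.1.1 0) = 1 then f p else 0 := by
  rw [star_pullback]
  change pullback (orbitEquiv A i).symm (pullback (orbitEquiv A i) f) p = _
  rw [pullback_apply]
  rcases h1 : (orbitEquiv A i).symm p with _ | q
  · rw [orbitEquiv_symm_apply] at h1
    split_ifs at h1 with h2
    rw [if_neg h2]
    rfl
  · change pullback (orbitEquiv A i) f q = _
    have h2 : orbitEquiv A i q = some p := (PEquiv.mem_iff_mem _).1 h1
    rw [pullback_apply, h2, if_pos]
    · rfl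
    · rw [orbitEquiv_symm_apply] at h1
      split_ifs at h1 with h3
      exact h3

/-- The range projection of the i-th operator is multiplication by the indicator of the cylinder of
i, and its source projection is multiplication by the indicator of the points that i may precede, so
the relations are identities between indicators. -/
theorem isCKFamily_pullback (hA01 : ∀ i j, A i j = 0 ∨ A i j = 1) :
    IsCKFamily A fun i => pullback (orbitEquiv A i) where
  partial_isometry i := by
    ext f p
    change (pullback (orbitEquiv A i) * star (pullback (orbitEquiv A i)))
      (pullback (orbitEquiv A i) f) p = _
    rw [pullback_range_apply, pullback_apply, orbitEquiv_apply]
    split_ifs <;> rfl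
  sum_range := by
    ext f p
    rw [sum_apply, lp.coeFn_sum, Finset.sum_apply]
    simp only [pullback_range_apply]
    simp
  source i := by
    ext f p
    rw [pullback_source_apply, sum_apply, lp.coeFn_sum, Finset.sum_apply]
    have h1 : ∀ j, (A i j • (pullback (orbitEquiv A j) * star (pullback (orbitEquiv A j)))) f p =
        A i j • if p.1.1 0 = j then f p else 0 := fun j => by
      rw [← pullback_range_apply j f p]
      rfl
    simp only [h1]
    rw [Finset.sum_eq_single (p.1.1 0)]
    · rcases hA01 i (p.1.1 0) with h | h <;> simp [h]
    · intro j _ hj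
      rw [if_neg (Ne.symm hj), smul_zero]
    · simp

/-! ### Matrix coefficients of the orbit representation and the conditional expectation. -/

namespace CKAlgebra

variable (hA01 : ∀ i j, A i j = 0 ∨ A i j = 1)

/-- The representation of `O_A` on `ℓ²(Λ_A × ℤ)` with `s i δ(x,k) = δ(i x, k + 1)`. -/
def orbitRep : CKAlgebra A →⋆ₐ[ℂ]
    (EllTwo (Subshift A × ℤ) →L[ℂ] EllTwo (Subshift A × ℤ)) :=
  lift (isCKFamily_pullback hA01)

theorem orbitRep_s (i : Fin d) : orbitRep hA01 (s A i) = pullback (orbitEquiv A i) :=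
  lift_s _ i

theorem orbitRep_star_s (i : Fin d) :
    orbitRep hA01 (star (s A i)) = pullback (orbitEquiv A i).symm := by
  rw [map_star, orbitRep_s, star_pullback]

theorem orbitRep_mul_apply (b c : CKAlgebra A) (f : EllTwo (Subshift A × ℤ)) :
    orbitRep hA01 (b * c) f = orbitRep hA01 b (orbitRep hA01 c f) := by
  rw [map_mul]
  rfl

theorem norm_orbitRep_le (b : CKAlgebra A) : ‖orbitRep hA01 b‖ ≤ ‖b‖ :=
  NonUnitalStarAlgHom.norm_apply_le (orbitRep hA01) b

/-- The matrix coefficient of `b` at `(p, q)` in the orbit representation. -/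
def coef (p q : Subshift A × ℤ) : CKAlgebra A →ₗ[ℂ] ℂ where
  toFun b := orbitRep hA01 b (basisVec q) p
  map_add' b c := by rw [map_add]; rfl
  map_smul' r b := by rw [map_smul]; rfl

theorem coef_def (p q : Subshift A × ℤ) (b : CKAlgebra A) :
    coef hA01 p q b = orbitRep hA01 b (basisVec q) p := rfl

theorem norm_coef_le (p q : Subshift A × ℤ) (b : CKAlgebra A) : ‖coef hA01 p q b‖ ≤ ‖b‖ := by
  refine (lp.norm_apply_le_norm (by norm_num) _ _).trans ?_
  refine ((orbitRep hA01 b).le_opNorm _).trans ?_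
  rw [norm_basisVec, mul_one]
  exact norm_orbitRep_le hA01 b

theorem continuous_coef (p q : Subshift A × ℤ) : Continuous (coef hA01 p q) :=
  AddMonoidHomClass.continuous_of_bound (coef hA01 p q) 1 fun b => by
    rw [one_mul]; exact norm_coef_le hA01 p q b

theorem coef_star (p q : Subshift A × ℤ) (b : CKAlgebra A) :
    coef hA01 p q (star b) = star (coef hA01 q p b) := by
  rw [coef_def, coef_def, map_star, ← inner_basisVec, ← inner_basisVec,
    ContinuousLinearMap.star_eq_adjoint, ContinuousLinearMap.adjoint_inner_right]
  exact (inner_conj_symm _ _).symm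

open scoped ComplexOrder in
theorem coef_star_mul_self_nonneg (p : Subshift A × ℤ) (b : CKAlgebra A) :
    0 ≤ coef hA01 p p (star b * b) := by
  rw [coef_def, orbitRep_mul_apply, map_star, ← inner_basisVec,
    ContinuousLinearMap.star_eq_adjoint, ContinuousLinearMap.adjoint_inner_right,
    inner_self_eq_norm_sq_to_K]
  rw [← RCLike.ofReal_pow]
  exact Complex.zero_le_real.2 (sq_nonneg _)

theorem coef_one (p : Subshift A × ℤ) : coef hA01 p p 1 = 1 := by
  rw [coef_def, map_one]
  change basisVec p p = 1
  rw [basisVec_apply, if_pos rfl]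

theorem coef_s_mul (i : Fin d) (p q : Subshift A × ℤ) (b : CKAlgebra A) :
    coef hA01 p q (s A i * b) =
      if p.1.1 0 = i then coef hA01 (shift p.1, p.2 - 1) q b else 0 := by
  rw [coef_def, orbitRep_mul_apply, orbitRep_s, pullback_apply, orbitEquiv_apply]
  split_ifs <;> rfl

/-- The generator s_i sends the basis vector at (x, k) to the one at (ix, k + 1), or to 0 if i may
not precede x. -/
theorem coef_mul_s (i : Fin d) (p q : Subshift A × ℤ) (b : CKAlgebra A) :
    coef hA01 p q (b * s A i) =
      if h : A i (q.1.1 0) = 1 then coef hA01 p (prepend i q.1 h, q.2 + 1) b else 0 := by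
  have h1 : orbitRep hA01 (s A i) (basisVec q) =
      if h : A i (q.1.1 0) = 1 then basisVec (prepend i q.1 h, q.2 + 1) else 0 := by
    ext p
    rw [orbitRep_s, pullback_apply]
    rcases h : orbitEquiv A i p with _ | r
    · split_ifs with h2
      · rw [basisVec_apply, if_neg]
        · rfl
        · rintro rfl
          rw [orbitEquiv_apply, if_pos (show (prepend i q.1 h2).1 0 = i from rfl)] at h
          simp at h
      · rfl
    · change basisVec q r = _
      have h3 := (PEquiv.mem_iff_mem _).2 h
      rw [Option.mem_def, orbitEquiv_symm_apply] at h3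
      split_ifs at h3 with h4
      rw [Option.some_inj] at h3
      subst h3
      rw [basisVec_apply]
      by_cases hrq : r = q
      · subst hrq
        rw [if_pos rfl, dif_pos h4, basisVec_apply, if_pos rfl]
      · rw [if_neg hrq]
        split_ifs with h5
        · rw [basisVec_apply, if_neg]
          intro e
          refine hrq (Prod.ext ?_ ?_)
          · simpa only [shift_prepend] using congrArg (fun z => shift z.1) e
          · simpa using congrArg Prod.snd e
        · rfl
  rw [coef_def, orbitRep_mul_apply, h1]
  split_ifs
  · rfl
  · rw [map_zero]; rfl

theorem coef_word_mul (w : List (Fin d)) (p q : Subshift A × ℤ) (b : CKAlgebra A) :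
    coef hA01 p q (word A w * b) = if initWord p.1.1 w.length = w then
      coef hA01 (shift^[w.length] p.1, p.2 - w.length) q b else 0 := by
  induction w generalizing p with
  | nil => simp [word_nil, initWord_zero]
  | cons i w ih =>
    rw [word_cons, mul_assoc, coef_s_mul, ih, List.length_cons, initWord_succ']
    simp only [List.cons.injEq, Function.iterate_succ, Function.comp_apply, Nat.cast_add,
      Nat.cast_one]
    rw [ite_and, sub_sub, add_comm (1 : ℤ)]

-- The coefficient detects tail equivalence: deleting v from p and w from q must give the same point
-- at the same level.
open Classical in
theorem coef_word_mul_star_word (v w : List (Fin d)) (p q : Subshift A × ℤ) :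
    coef hA01 p q (word A v * star (word A w)) =
      if initWord p.1.1 v.length = v ∧ initWord q.1.1 w.length = w ∧
        shift^[v.length] p.1 = shift^[w.length] q.1 ∧ p.2 - v.length = q.2 - w.length
      then 1 else 0 := by
  have h1 : ∀ p q : Subshift A × ℤ, coef hA01 p q 1 = if p = q then 1 else 0 := fun p q => by
    rw [coef_def, map_one]
    exact (basisVec_apply q p).trans (by split_ifs <;> rfl)
  rw [coef_word_mul, coef_star, ← mul_one (word A w), coef_word_mul, h1, ite_and, ite_and]
  split_ifs with h2 h3 h4 h5 h5
  · simp
  · exact absurd ⟨(congrArg Prod.fst h4).symm, (congrArg Prod.snd h4).symm⟩ h5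
  · exact absurd (Prod.ext h5.1.symm h5.2.symm) h4
  · simp
  · simp
  · rfl

-- By the formula on words, coefficients depend only on the difference of the two levels. This
-- brings shifted coefficients back to level 0 in `expectation_mul_s`.
open Classical in
theorem coef_translate (m k l : ℤ) (x y : Subshift A) (b : CKAlgebra A) :
    coef hA01 (x, k + m) (y, l + m) b = coef hA01 (x, k) (y, l) b := by
  induction b using induction_on_word with
  | hp => exact isClosed_eq (continuous_coef hA01 _ _) (continuous_coef hA01 _ _)
  | h0 => rw [map_zero, map_zero]
  | hadd b c hb hc => rw [map_add, map_add, hb, hc]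
  | hsmul r b hb => rw [map_smul, map_smul, hb]
  | hw v w =>
    rw [coef_word_mul_star_word, coef_word_mul_star_word]
    have : k + m - v.length = l + m - w.length ↔ k - v.length = l - w.length := by
      constructor <;> intro h <;> linarith
    exact if_congr (and_congr_right fun _ => and_congr_right fun _ => and_congr_right fun _ => this)
      rfl rfl

/-- This is why the ℤ coordinate is there: equality of levels forces v and w to have the same
length. Without it, eventually periodic points x could contribute for words of different lengths,
and the coefficient could fail to be continuous in x. -/
theorem coef_diag_word (v w : List (Fin d)) (x : Subshift A) :
    coef hA01 (x, 0) (x, 0) (word A v * star (word A w)) =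
      if v = w then cylinderIndicator A v x else 0 := by
  rw [coef_word_mul_star_word, cylinderIndicator_apply]
  by_cases hvw : v = w
  · subst hvw
    simp
  · rw [if_neg hvw, if_neg]
    rintro ⟨h1, h2, -, h3⟩
    have h4 : v.length = w.length := by simpa using h3
    rw [h4, h2] at h1
    exact hvw h1.symm

/-- Coefficients are bounded by the norm, so they converge uniformly in x when b is approximated; on
words they are cylinder indicators or 0. -/
theorem continuous_coef_diag (b : CKAlgebra A) :
    Continuous fun x => coef hA01 (x, 0) (x, 0) b := by
  induction b using induction_on_word with
  | hp =>
    refine isClosed_of_closure_subset fun b hb => ?_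
    refine continuous_of_uniform_approx_of_continuous fun u hu => ?_
    obtain ⟨ε, hε, hu⟩ := Metric.mem_uniformity_dist.1 hu
    obtain ⟨c, hc, hbc⟩ := Metric.mem_closure_iff.1 hb ε hε
    refine ⟨_, hc, fun x => hu ?_⟩
    rw [dist_eq_norm, ← map_sub]
    exact (norm_coef_le hA01 _ _ _).trans_lt (by rwa [← dist_eq_norm])
  | h0 => simpa using continuous_const
  | hadd b c hb hc => simp only [map_add]; exact hb.add hc
  | hsmul r b hb => simpa using hb.const_mul r
  | hw v w =>
    simp only [coef_diag_word]
    split_ifs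
    · exact (cylinderIndicator A v).continuous
    · exact continuous_const

/-- The conditional expectation of `O_A` onto `C(Λ_A)`. -/
def expectation : CKAlgebra A →L[ℂ] C(Subshift A, ℂ) :=
  LinearMap.mkContinuous
    { toFun := fun b => ⟨fun x => coef hA01 (x, 0) (x, 0) b, continuous_coef_diag hA01 b⟩
      map_add' := fun b c => by ext x; exact map_add (coef hA01 (x, 0) (x, 0)) b c
      map_smul' := fun r b => by ext x; exact map_smul (coef hA01 (x, 0) (x, 0)) r b }
    1 fun b => by
      rw [one_mul]
      exact (ContinuousMap.norm_le _ (norm_nonneg b)).2 fun x => norm_coef_le hA01 _ _ b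

theorem expectation_apply (b : CKAlgebra A) (x : Subshift A) :
    expectation hA01 b x = coef hA01 (x, 0) (x, 0) b := rfl

/-- The diagonal acts by multiplication operators. Hence the expectation is the identity on C(Λ_A),
and left and right multiplication by f have the same effect on diagonal coefficients. -/
theorem orbitRep_diagEmbedding_apply (f : C(Subshift A, ℂ)) (g : EllTwo (Subshift A × ℤ))
    (p : Subshift A × ℤ) : orbitRep hA01 (diagEmbedding A f) g p = f p.1 * g p := by
  induction f using continuousMap_induction generalizing g p with
  | hp =>
    simp only [Set.ofPred_forall]
    refine isClosed_iInter fun g => isClosed_iInter fun p => isClosed_eq ?_ ?_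
    · have h1 : Continuous fun b => orbitRep hA01 b g p := by
        refine AddMonoidHomClass.continuous_of_bound
          (AddMonoidHom.mk' (fun b => orbitRep hA01 b g p) fun b c => by rw [map_add]; rfl) ‖g‖
          fun b => ?_
        refine (lp.norm_apply_le_norm (by norm_num) _ _).trans ?_
        refine ((orbitRep hA01 b).le_opNorm _).trans ?_
        rw [mul_comm]
        gcongr
        exact norm_orbitRep_le hA01 b
      exact h1.comp continuous_diagEmbedding
    · exact (continuous_eval_const p.1).mul continuous_const
  | hc c =>
    rw [AlgHomClass.commutes, AlgHomClass.commutes, Algebra.algebraMap_eq_smul_one]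
    rfl
  | hw w =>
    rw [diagEmbedding_cylinderIndicator]
    induction w generalizing g p with
    | nil => simp [wordProj_nil, cylinderIndicator_nil]
    | cons i w ih =>
      have h1 := pullback_range_apply i g p
      rw [star_pullback] at h1
      change pullback (orbitEquiv A i) (pullback (orbitEquiv A i).symm g) p = _ at h1
      rw [wordProj_cons, mul_assoc, orbitRep_mul_apply, orbitRep_mul_apply, orbitRep_s,
        orbitRep_star_s]
      rw [pullback_apply, orbitEquiv_apply] at h1 ⊢
      rw [cylinderIndicator_apply, List.length_cons, initWord_succ']
      split_ifs at h1 ⊢ with h2 h3 h3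
      · simp only [Option.elim_some] at h1 ⊢
        rw [ih, h1, cylinderIndicator_apply, if_pos (List.cons.inj h3).2]
      · simp only [Option.elim_some]
        rw [ih, cylinderIndicator_apply, if_neg, zero_mul, zero_mul]
        intro h4
        exact h3 (by rw [h2, h4])
      · exact absurd (List.cons.inj h3).1 h2
      · simp
  | hadd f f' hf hf' =>
    rw [map_add, map_add, ContinuousMap.add_apply, add_mul, ← hf, ← hf']
    rfl
  | hmul f f' hf hf' =>
    rw [map_mul, orbitRep_mul_apply, hf, hf', ContinuousMap.mul_apply, mul_assoc]

theorem coef_diagEmbedding_mul (f : C(Subshift A, ℂ)) (p q : Subshift A × ℤ) (b : CKAlgebra A) :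
    coef hA01 p q (diagEmbedding A f * b) = f p.1 * coef hA01 p q b := by
  rw [coef_def, orbitRep_mul_apply, orbitRep_diagEmbedding_apply]
  rfl

theorem coef_mul_diagEmbedding (f : C(Subshift A, ℂ)) (p q : Subshift A × ℤ) (b : CKAlgebra A) :
    coef hA01 p q (b * diagEmbedding A f) = f q.1 * coef hA01 p q b := by
  have h := congrArg star (coef_diagEmbedding_mul hA01 (star f) q p (star b))
  rw [← coef_star, star_mul, star_star, ← map_star, star_star, star_mul, ← coef_star,
    star_star, mul_comm] at h
  rw [h]
  change star (star (f q.1)) * _ = _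
  rw [star_star]

theorem expectation_diagEmbedding (f : C(Subshift A, ℂ)) :
    expectation hA01 (diagEmbedding A f) = f := by
  ext x
  have := coef_diagEmbedding_mul hA01 f (x, 0) (x, 0) 1
  rwa [mul_one, coef_one, mul_one] at this

theorem expectation_comm (f : C(Subshift A, ℂ)) (b : CKAlgebra A) :
    expectation hA01 (b * diagEmbedding A f) = expectation hA01 (diagEmbedding A f * b) := by
  ext x
  rw [expectation_apply, expectation_apply, coef_mul_diagEmbedding, coef_diagEmbedding_mul]

/-- The expectation exchanges the two sides of the conformality relation through the Ruelle
operator. -/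
theorem expectation_mul_s (a : selfAdjoint C(Subshift A, ℂ)) (β : ℝ) (i : Fin d)
    (b : CKAlgebra A) :
    expectation hA01 (b * diagEmbedding A (phaseExt a β I) * s A i) =
      Real.exp (-β) • ruelle a.1 (expectation hA01 (s A i * b)) := by
  ext x
  -- The expectation of s_i b vanishes off the cylinder of i, so only the i-th branch survives.
  rw [ContinuousMap.smul_apply, ruelle_eq, ContinuousMap.sum_apply, Finset.sum_eq_single i]
  · rw [expectation_apply, coef_mul_s, branch_apply]
    split_ifs with h
    · rw [coef_mul_diagEmbedding, ContinuousMap.mul_apply, expectation_apply, coef_s_mul,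
        if_pos (by rfl), shift_prepend, phaseExt_I, ContinuousMap.smul_apply, smul_mul_assoc]
      -- One side has levels (0, 1) and the other (-1, 0); translating by 1 matches them.
      have := coef_translate hA01 1 (0 - 1) 0 x (prepend i x h) b
      rw [sub_add_cancel] at this
      rw [this]
    · rw [smul_zero]
  · intro j _ hj
    rw [branch_apply]
    split_ifs with h
    · rw [ContinuousMap.mul_apply, expectation_apply, coef_s_mul, if_neg (by exact hj), mul_zero]
    · rfl
  · simp

/-! ### The state attached to a probability measure -/

open MeasureTheory

theorem _root_.CuntzKrieger.integrable_continuousMap (μ : Measure (Subshift A))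
    [IsProbabilityMeasure μ] (f : C(Subshift A, ℂ)) : Integrable f μ :=
  f.continuous.integrable_of_hasCompactSupport (HasCompactSupport.of_compactSpace f)

/-- Integration against a probability measure. -/
def _root_.CuntzKrieger.integralCLM (μ : ProbabilityMeasure (Subshift A)) :
    C(Subshift A, ℂ) →L[ℂ] ℂ :=
  LinearMap.mkContinuous
    { toFun := fun f => ∫ x, f x ∂(μ : Measure (Subshift A))
      map_add' := fun f g =>
        integral_add (integrable_continuousMap _ f) (integrable_continuousMap _ g)
      map_smul' := fun c f => integral_const_mul c _ }
    1 fun f => by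
      have := norm_integral_le_of_norm_le_const (μ := (μ : Measure (Subshift A)))
        (Eventually.of_forall fun x => f.norm_coe_le_norm x)
      simpa using this

/-- The functional `b ↦ ∫ E b dμ` on `O_A`. -/
def measureState (μ : ProbabilityMeasure (Subshift A)) : CKAlgebra A →L[ℂ] ℂ :=
  (integralCLM μ).comp (expectation hA01)

theorem measureState_eq (μ : ProbabilityMeasure (Subshift A)) (b : CKAlgebra A) :
    measureState hA01 μ b = integralCLM μ (expectation hA01 b) := rfl

theorem measureState_apply (μ : ProbabilityMeasure (Subshift A)) (b : CKAlgebra A) :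
    measureState hA01 μ b = ∫ x, expectation hA01 b x ∂(μ : Measure (Subshift A)) := rfl

theorem measureState_diagEmbedding (μ : ProbabilityMeasure (Subshift A)) (f : C(Subshift A, ℂ)) :
    measureState hA01 μ (diagEmbedding A f) = ∫ x, f x ∂(μ : Measure (Subshift A)) := by
  rw [measureState_apply, expectation_diagEmbedding]

open scoped ComplexOrder in
theorem isState_measureState (μ : ProbabilityMeasure (Subshift A)) :
    IsState (measureState hA01 μ) where
  map_one := by
    rw [← map_one (diagEmbedding A), measureState_diagEmbedding]
    simp
  nonneg b := by
    rw [measureState_apply]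
    exact integral_nonneg fun x => coef_star_mul_self_nonneg hA01 (x, 0) b

/-- Integrating `expectation_mul_s` against an eigenmeasure cancels e^{-β} against the eigenvalue
e^β. -/
theorem isConformal_measureState {a : selfAdjoint C(Subshift A, ℂ)} {β : ℝ}
    (μ : eigenmeasures a β) : IsConformal a β (measureState hA01 μ.1) where
  apply_mul_s i x := by
    have h := μ.2 (expectation hA01 (s A i * x))
    change integralCLM μ.1 _ = _ * integralCLM μ.1 _ at h
    rw [measureState_eq, measureState_eq, expectation_mul_s, RCLike.real_smul_eq_coe_smul (K := ℂ),
      map_smul, h, smul_eq_mul, ← mul_assoc]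
    have e : ((Real.exp (-β) : ℝ) : ℂ) * ((Real.exp β : ℝ) : ℂ) = 1 := by
      rw [← ofReal_mul, ← Real.exp_add, neg_add_cancel, Real.exp_zero, ofReal_one]
    exact (congrArg (· * _) e).trans (one_mul _)
  apply_comm f x := by
    rw [measureState_eq, measureState_eq, expectation_comm]

end CKAlgebra

open MeasureTheory

/-! ### The measure of a state on a commutative algebra -/

section
variable {X : Type*} [TopologicalSpace X]

/-- A real-valued continuous function, regarded as complex-valued. -/
def ofRealMap (f : C(X, ℝ)) : C(X, ℂ) := ⟨fun x => (f x : ℂ), by fun_prop⟩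

theorem star_ofRealMap (f : C(X, ℝ)) : star (ofRealMap f) = ofRealMap f := by
  ext x
  exact conj_ofReal _

variable [CompactSpace X] [T2Space X] [MeasurableSpace X] [BorelSpace X] {ψ : C(X, ℂ) →L[ℂ] ℂ}

open CompactlySupported in
/-- The real positive functional of a state. -/
def IsState.realFunctional (h : IsState ψ) : C_c(X, ℝ) →ₚ[ℝ] ℝ :=
  PositiveLinearMap.mk₀
    { toFun := fun f => (ψ (ofRealMap f.toContinuousMap)).re
      map_add' := fun f g => by
        rw [← add_re, ← map_add]
        congr 2
        ext x
        exact ofReal_add _ _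
      map_smul' := fun c f => by
        have e : ofRealMap (c • f).toContinuousMap = (c : ℂ) • ofRealMap f.toContinuousMap := by
          ext x
          exact ofReal_mul _ _
        rw [e, map_smul, smul_eq_mul, re_ofReal_mul]
        rfl } fun f hf => by
    -- A nonnegative function is the square of its root, which brings it to the form star x * x in
    -- which positivity of a state is given.
    let g : C(X, ℝ) := ⟨fun x => √(f x), by fun_prop⟩
    have e : ofRealMap f.toContinuousMap = star (ofRealMap g) * ofRealMap g := by
      rw [star_ofRealMap]
      ext x
      change ((f x : ℝ) : ℂ) = (√(f x) : ℝ) * (√(f x) : ℝ)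
      rw [← ofReal_mul, Real.mul_self_sqrt (hf x)]
    change 0 ≤ (ψ (ofRealMap f.toContinuousMap)).re
    rw [e]
    exact (Complex.le_def.1 (h.nonneg _)).1

/-- Riesz–Markov–Kakutani for real functions, on which ψ is real because it is hermitian; complex
functions follow from their real and imaginary parts, and ψ(1) = 1 gives total mass one. -/
theorem IsState.exists_measure (h : IsState ψ) :
    ∃ μ : ProbabilityMeasure X, ∀ f, ψ f = ∫ x, f x ∂(μ : Measure X) := by
  set μ : Measure X := RealRMK.rieszMeasure h.realFunctional with hμ
  have hre : ∀ f : C(X, ℝ), ψ (ofRealMap f) = ((∫ x, f x ∂μ : ℝ) : ℂ) := fun f => by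
    have h1 := RealRMK.integral_rieszMeasure h.realFunctional
      (CompactlySupportedContinuousMap.continuousMapEquiv f)
    have h2 : (ψ (ofRealMap f)).im = 0 := by
      have := h.star_apply (ofRealMap f)
      rw [star_ofRealMap] at this
      exact conj_eq_iff_im.1 this.symm
    apply Complex.ext
    · exact h1.symm
    · rw [h2, ofReal_im]
  have hprob : IsProbabilityMeasure μ := by
    have h1 := hre 1
    have e : ofRealMap (1 : C(X, ℝ)) = 1 := by
      ext x
      exact ofReal_one
    rw [e, h.map_one] at h1
    have h2 : μ.real Set.univ = 1 := by
      have : (1 : ℝ) = ∫ x, (1 : C(X, ℝ)) x ∂μ := by exact_mod_cast h1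
      rw [this]
      simp
    refine ⟨?_⟩
    rw [measureReal_def] at h2
    rwa [← ENNReal.toReal_eq_one_iff]
  refine ⟨⟨μ, hprob⟩, fun f => ?_⟩
  let u : C(X, ℝ) := ⟨fun x => (f x).re, by fun_prop⟩
  let v : C(X, ℝ) := ⟨fun x => (f x).im, by fun_prop⟩
  have e : f = ofRealMap u + I • ofRealMap v := by
    ext x
    change f x = (f x).re + I * (f x).im
    rw [mul_comm, re_add_im]
  have hint : Integrable (fun x => f x) μ :=
    f.continuous.integrable_of_hasCompactSupport (HasCompactSupport.of_compactSpace _)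
  have h1 := integral_re_add_im hint
  change _ = ∫ x, f x ∂μ
  rw [← h1]
  conv_lhs => rw [e]
  rw [map_add, map_smul, hre, hre, smul_eq_mul, mul_comm]
  rfl

end

/-! ### The spectral radius -/

section
attribute [local instance] Matrix.linftyOpNormedRing Matrix.linftyOpNormedAlgebra

/-- The chain r(A)^n ≤ r(A^n) ≤ ‖A^n‖, where the norm is the largest row sum, which is at most the
sum of all entries. -/
theorem specRadius_pow_le [Nonempty (Fin d)] (n : ℕ) :
    specRadius A ^ n ≤ ∑ i, ∑ j, ((A ^ n) i j : ℝ) := by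
  set M : Matrix (Fin d) (Fin d) ℂ := A.map (Nat.cast : ℕ → ℂ) with hM
  have hpow : M ^ n = (A ^ n).map (Nat.cast : ℕ → ℂ) :=
    (map_pow (Nat.castRingHom ℂ).mapMatrix A n).symm
  have h1 : spectralRadius ℂ M ^ n ≤ (‖M ^ n‖₊ : ENNReal) :=
    (spectrum.spectralRadius_pow_le' M n).trans (spectrum.spectralRadius_le_nnnorm _)
  have h2 : specRadius A ^ n ≤ ‖M ^ n‖ := by
    have := ENNReal.toReal_mono ENNReal.coe_ne_top h1
    rwa [ENNReal.toReal_pow] at this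
  refine h2.trans ?_
  rw [Matrix.linfty_opNorm_def]
  have h3 : (Finset.univ.sup fun i => ∑ j, ‖(M ^ n) i j‖₊) ≤ ∑ i, ∑ j, ((A ^ n) i j : NNReal) := by
    refine Finset.sup_le fun i _ => ?_
    have h4 : ∀ i j, ‖(M ^ n) i j‖₊ = ((A ^ n) i j : NNReal) := fun i j => by
      rw [hpow, Matrix.map_apply]
      simp
    simp only [h4]
    exact Finset.single_le_sum (f := fun i => ∑ j, ((A ^ n) i j : NNReal))
      (fun _ _ => bot_le) (Finset.mem_univ i)
  exact_mod_cast h3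

end

/-! ### Growth of the iterates of the Ruelle operator -/

theorem ruelle_apply (a f : C(Subshift A, ℂ)) (x : Subshift A) :
    ruelle a f x = ∑ i, if h : A i (x.1 0) = 1 then
      exp (a (prepend i x h)) * f (prepend i x h) else 0 := rfl

/-- L_a^n 1 at x sums the exponentials of Birkhoff sums over the words of length n that may precede
x. Each term is at least e^{nm}, and the words are counted by a column sum of A^n. -/
theorem ruelle_iterate_one (hA01 : ∀ i j, A i j = 0 ∨ A i j = 1)
    (a : selfAdjoint C(Subshift A, ℂ)) {m : ℝ} (hm : ∀ x, m ≤ (a.1 x).re) (n : ℕ)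
    (x : Subshift A) : (((ruelle a.1)^[n] 1) x).im = 0 ∧
      Real.exp (n * m) * ∑ j, ((A ^ n) j (x.1 0) : ℝ) ≤ (((ruelle a.1)^[n] 1) x).re := by
  induction n generalizing x with
  | zero => simp [Matrix.one_apply]
  | succ n ih =>
    have hexp : ∀ y, exp (a.1 y) = (Real.exp (a.1 y).re : ℂ) := fun y => by
      rw [ofReal_exp, ofReal_re_of_selfAdjoint]
    rw [Function.iterate_succ_apply', ruelle_apply, im_sum, re_sum]
    constructor
    · refine Finset.sum_eq_zero fun i _ => ?_
      split_ifs with h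
      · rw [hexp, im_ofReal_mul, (ih _).1, mul_zero]
      · rfl
    · have e : Real.exp ((n + 1 : ℕ) * m) * ∑ j, ((A ^ (n + 1)) j (x.1 0) : ℝ) =
          ∑ i, (A i (x.1 0) : ℝ) *
            (Real.exp m * (Real.exp (n * m) * ∑ j, ((A ^ n) j i : ℝ))) := by
        have e1 : Real.exp ((n + 1 : ℕ) * m) = Real.exp m * Real.exp (n * m) := by
          rw [← Real.exp_add]
          congr 1
          push_cast
          ring
        simp only [pow_succ, Matrix.mul_apply, Nat.cast_sum, Nat.cast_mul]
        rw [Finset.sum_comm, e1, Finset.mul_sum]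
        refine Finset.sum_congr rfl fun i _ => ?_
        rw [← Finset.sum_mul]
        ring
      rw [e]
      refine Finset.sum_le_sum fun i _ => ?_
      split_ifs with h
      · rw [h, Nat.cast_one, one_mul, hexp, re_ofReal_mul]
        refine mul_le_mul (Real.exp_le_exp.2 (hm _)) ((ih (prepend i x h)).2) (by positivity)
          (Real.exp_nonneg _)
      · rw [(hA01 i (x.1 0)).resolve_right h]
        simp

theorem integral_ruelle_iterate {a : selfAdjoint C(Subshift A, ℂ)} {β : ℝ}
    (μ : eigenmeasures a β) (n : ℕ) :
    ∫ x, ((ruelle a.1)^[n] 1) x ∂(μ.1 : Measure (Subshift A)) = (Real.exp (n * β) : ℂ) := by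
  induction n with
  | zero => simp
  | succ n ih =>
    rw [Function.iterate_succ_apply', μ.2, ih, ← ofReal_mul, ← Real.exp_add]
    congr 2
    push_cast
    ring

/-- Positive integer entries of A^N are at least 1, so N further steps lead from any letter to k.
This bounds every column sum below independently of the column, as needed for a pointwise estimate
in x. -/
theorem sum_pow_le_sum_pow_add {N : ℕ} (hN : ∀ i j, 0 < (A ^ N) i j) (n : ℕ) (k : Fin d) :
    ∑ i, ∑ j, ((A ^ n) i j : ℝ) ≤ ∑ i, ((A ^ (n + N)) i k : ℝ) := by
  refine Finset.sum_le_sum fun i _ => ?_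
  rw [pow_add, Matrix.mul_apply, Nat.cast_sum]
  refine Finset.sum_le_sum fun j _ => ?_
  exact_mod_cast Nat.le_mul_of_pos_right _ (hN j k)

theorem exp_mul_specRadius_pow_le (hA01 : ∀ i j, A i j = 0 ∨ A i j = 1)
    {a : selfAdjoint C(Subshift A, ℂ)} {β : ℝ} (μ : eigenmeasures a β) {m : ℝ}
    (hm : ∀ x, m ≤ (a.1 x).re) {N : ℕ} (hN : ∀ i j, 0 < (A ^ N) i j) (n : ℕ) :
    Real.exp ((n + N : ℕ) * m) * specRadius A ^ n ≤ Real.exp ((n + N : ℕ) * β) := by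
  obtain ⟨x₀⟩ : Nonempty (Subshift A) := μ.1.nonempty
  have : Nonempty (Fin d) := ⟨x₀.1 0⟩
  have hint := integrable_continuousMap (μ.1 : Measure (Subshift A)) ((ruelle a.1)^[n + N] 1)
  have h1 := congrArg re (integral_ruelle_iterate μ (n + N))
  rw [ofReal_re] at h1
  have h2 : (∫ x, ((ruelle a.1)^[n + N] 1) x ∂(μ.1 : Measure (Subshift A))).re =
      ∫ x, (((ruelle a.1)^[n + N] 1) x).re ∂(μ.1 : Measure (Subshift A)) :=
    (integral_re hint).symm
  rw [← h1, h2]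
  have h3 : Real.exp ((n + N : ℕ) * m) * specRadius A ^ n =
      ∫ _, Real.exp ((n + N : ℕ) * m) * specRadius A ^ n ∂(μ.1 : Measure (Subshift A)) := by simp
  rw [h3]
  refine integral_mono (integrable_const _) hint.re fun x => ?_
  refine le_trans ?_ (ruelle_iterate_one hA01 a hm (n + N) x).2
  gcongr
  exact (specRadius_pow_le n).trans (sum_pow_le_sum_pow_add hN n _)

/-- The exponential estimate holds for all n with N fixed, so comparing the terms linear in n
removes the influence of N. -/
theorem log_specRadius_le (hA01 : ∀ i j, A i j = 0 ∨ A i j = 1) (hA : IsAperiodic A)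
    {a : selfAdjoint C(Subshift A, ℂ)} {β : ℝ} (μ : eigenmeasures a β) {m : ℝ}
    (hm : ∀ x, m ≤ (a.1 x).re) (hr : 0 < specRadius A) :
    Real.log (specRadius A) ≤ β - m := by
  obtain ⟨N, -, hN⟩ := hA
  have key : ∀ n : ℕ, n * (Real.log (specRadius A) - (β - m)) ≤ N * (β - m) := fun n => by
    have h := exp_mul_specRadius_pow_le hA01 μ hm hN n
    rw [← Real.exp_log hr, ← Real.exp_nat_mul, ← Real.exp_add, Real.exp_le_exp] at h
    push_cast at h
    linarith
  by_contra! hlt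
  have hδ := sub_pos.2 hlt
  obtain ⟨n, hn⟩ := exists_nat_gt (N * (β - m) / (Real.log (specRadius A) - (β - m)))
  rw [div_lt_iff₀ hδ] at hn
  exact absurd (key n) (not_le.2 hn)

theorem norm_phaseExt_I_lt_one (hA01 : ∀ i j, A i j = 0 ∨ A i j = 1) (hA : IsAperiodic A)
    {a : selfAdjoint C(Subshift A, ℂ)} {β : ℝ} (μ : eigenmeasures a β)
    (hvar : var₀ a.1 < Real.log (specRadius A)) : ‖CKAlgebra.phaseExt a β I‖ < 1 := by
  obtain ⟨x₀⟩ : Nonempty (Subshift A) := μ.1.nonempty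
  have hb : ∀ x, |(a.1 x).re| ≤ ‖a.1‖ := fun x =>
    (abs_re_le_norm _).trans (a.1.norm_coe_le_norm x)
  have hsup : ∀ x, (a.1 x).re ≤ ⨆ y, (a.1 y).re :=
    le_ciSup ⟨‖a.1‖, by rintro _ ⟨x, rfl⟩; exact (abs_le.1 (hb x)).2⟩
  have hinf : ∀ x, ⨅ y, (a.1 y).re ≤ (a.1 x).re :=
    ciInf_le ⟨-‖a.1‖, by rintro _ ⟨x, rfl⟩; exact (abs_le.1 (hb x)).1⟩
  -- If r(A) were 0, its `Real.log` would be 0 by convention, and the oscillation of a would have to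
  -- be negative.
  have hr : 0 < specRadius A := by
    refine lt_of_le_of_ne ENNReal.toReal_nonneg fun h => ?_
    rw [← h, Real.log_zero, var₀] at hvar
    linarith [hsup x₀, hinf x₀]
  have hlog := log_specRadius_le hA01 hA μ hinf hr
  -- Combine max a - min a < log r(A) with log r(A) ≤ β - min a.
  have hM : (⨆ y, (a.1 y).re) < β := by
    rw [var₀] at hvar
    linarith
  refine lt_of_le_of_lt ((ContinuousMap.norm_le _ (Real.exp_nonneg _)).2 fun x => ?_)
    (Real.exp_lt_one_iff.2 (sub_neg.2 hM))
  rw [CKAlgebra.phaseExt_apply, norm_exp, I_mul_I, ← ofReal_re_of_selfAdjoint a x]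
  refine Real.exp_le_exp.2 ?_
  simpa using hsup x

/-! ### The restriction map -/

open scoped ComplexOrder in
open CKAlgebra in
/-- The restriction of a state of `O_A` to the diagonal is a state. -/
theorem IsState.comp_diagEmbedding {ω : CKAlgebra A →L[ℂ] ℂ} (h : IsState ω) :
    IsState (ω.comp (⟨(diagEmbedding A).toAlgHom.toLinearMap, continuous_diagEmbedding⟩ :
      C(Subshift A, ℂ) →L[ℂ] CKAlgebra A)) where
  map_one := (congrArg ω (_root_.map_one (diagEmbedding A))).trans h.map_one
  nonneg f := by
    refine (h.nonneg (diagEmbedding A f)).trans_eq (congrArg ω ?_)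
    rw [← map_star, ← map_mul]
    rfl

open CKAlgebra in
-- The Riesz measure of the restricted state inherits the eigenvalue equation from conformality.
theorem exists_eigenmeasure (hA01 : ∀ i j, A i j = 0 ∨ A i j = 1)
    {a : selfAdjoint C(Subshift A, ℂ)} {β : ℝ} (ω : kmsStates a β) :
    ∃ μ : eigenmeasures a β, ∀ f : C(Subshift A, ℂ),
      ω.1 (diagEmbedding A f) = ∫ x, f x ∂(μ.1 : Measure (Subshift A)) := by
  obtain ⟨μ, hμ⟩ := (IsKMSState.isState ω.2).comp_diagEmbedding.exists_measure
  have hμ' : ∀ f, ω.1 (diagEmbedding A f) = ∫ x, f x ∂(μ : Measure (Subshift A)) := hμ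
  refine ⟨⟨μ, fun f => ?_⟩, hμ'⟩
  rw [← hμ', ← hμ', (IsKMSState.isConformal ω.2).apply_ruelle hA01]

/-- Λ_A is metrizable, so its finite Borel measures are determined by integrals of continuous
functions. This makes the restriction map independent of the choice of representing measure. -/
theorem eq_of_forall_integral_eq {μ ν : ProbabilityMeasure (Subshift A)}
    (h : ∀ f : C(Subshift A, ℂ), ∫ x, f x ∂(μ : Measure (Subshift A)) =
      ∫ x, f x ∂(ν : Measure (Subshift A))) : μ = ν := by
  have : SecondCountableTopology (Subshift A) :=
    TopologicalSpace.Subtype.secondCountableTopology _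
  have := TopologicalSpace.metrizableSpace_of_t3_secondCountable (Subshift A)
  let := TopologicalSpace.metrizableSpaceMetric (Subshift A)
  have : IsProbabilityMeasure (μ : Measure (Subshift A)) := μ.2
  have : IsProbabilityMeasure (ν : Measure (Subshift A)) := ν.2
  have key : (μ : Measure (Subshift A)) = ν := by
    refine ext_of_forall_integral_eq_of_IsFiniteMeasure fun f => ?_
    have h1 := h (ofRealMap f.toContinuousMap)
    have h2 : ∀ ρ : Measure (Subshift A), ∫ x, ofRealMap f.toContinuousMap x ∂ρ =
        ((∫ x, f x ∂ρ : ℝ) : ℂ) := fun ρ => integral_ofReal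
    rw [h2, h2] at h1
    exact_mod_cast h1
  exact Subtype.ext key

end CuntzKrieger

end

theorem proposition7p6 {d : ℕ} (A : Matrix (Fin d) (Fin d) ℕ)
    (hA01 : ∀ i j, A i j = 0 ∨ A i j = 1) (hA : CuntzKrieger.IsAperiodic A)
    (a : selfAdjoint C(CuntzKrieger.Subshift A, ℂ)) (β : ℝ) :
    ∃ Φ : CuntzKrieger.kmsStates a β → CuntzKrieger.eigenmeasures a β,
      (∀ (ω : CuntzKrieger.kmsStates a β) (f : C(CuntzKrieger.Subshift A, ℂ)),
        ω.1 (CuntzKrieger.CKAlgebra.diagEmbedding A f) =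
          ∫ x, f x ∂((Φ ω).1 : MeasureTheory.Measure (CuntzKrieger.Subshift A))) ∧
      Function.Surjective Φ ∧
      (CuntzKrieger.var₀ a.1 < Real.log (CuntzKrieger.specRadius A) →
        Function.Bijective Φ) := by
  choose Φ hΦ using CuntzKrieger.exists_eigenmeasure (a := a) (β := β) hA01
  -- The preimage of μ is the state ∫ E(·) dμ.
  have hsurj : Function.Surjective Φ := fun μ => by
    have hstate := CuntzKrieger.CKAlgebra.isState_measureState hA01 μ.1
    refine ⟨⟨_, (CuntzKrieger.CKAlgebra.isConformal_measureState hA01 μ).isKMSState hstate⟩,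
      Subtype.ext (CuntzKrieger.eq_of_forall_integral_eq fun f => ?_)⟩
    rw [← hΦ]
    exact CuntzKrieger.CKAlgebra.measureState_diagEmbedding hA01 μ.1 f
  refine ⟨Φ, hΦ, hsurj, fun hvar => ⟨fun ω ω' h => Subtype.ext ?_, hsurj⟩⟩
  -- The common eigenmeasure Φ ω itself supplies the bound ‖U(i)‖ < 1, and equality of measures
  -- gives equality on the diagonal.
  refine (CuntzKrieger.IsKMSState.isConformal ω.2).eq_of_diagEmbedding
    (CuntzKrieger.IsKMSState.isState ω.2) (CuntzKrieger.IsKMSState.isConformal ω'.2)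
    (CuntzKrieger.IsKMSState.isState ω'.2) hA01
    (CuntzKrieger.norm_phaseExt_I_lt_one hA01 hA (Φ ω) hvar) fun f => ?_
  rw [hΦ, hΦ, h]
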